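/- Setup. Fix integers $M\ge 1$, $n\ge 1$, $0\le k\le 2n$ and $M/2\le L\le M$, a finite field $\mathbb F$, and put $q=\max(n,k)$, $\alpha=k/n\in[0,2]$. Two transmitter–receiver pairs (users) $i\in\{1,2\}$ communicate over $M$ subcarriers. In each channel use $t=1,\dots,N$, transmitter $i$ sends a vector $x^i_j(t)\in\mathbb F^q$ on each subcarrier $j$. With $G$ the $q\times q$ downward shift matrix and $i'\ne i$ the other user, receiver $i$ observes $G^{q-n}x^i_j(t)+G^{q-k}x^{i'}_j(t)$ if its subcarrier $j$ is interfered, and $G^{q-n}x^i_j(t)$ otherwise. The set of interfered subcarriers of a receiver is constant over the block, known to that receiver and unknown to the transmitters. Each user has independent, uniformly distributed messages $W^i_0,W^i_L,W^i_M$, and the messages of the two users are independent. Receiver $i$ must decode $W^i_M$ when all its $M$ subcarriers are interfered, $(W^i_L,W^i_M)$ when any set of exactly $L$ of its subcarriers is interfered, and $(W^i_0,W^i_L,W^i_M)$ when none is interfered. A tuple $(R_0,R_L,R_M)$ of symmetric rates (in symbols of $\mathbb F$ per channel use) is achievable if for every $\varepsilon>0$ and all sufficiently large $N$ there is a code of block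 length $N$ whose message rates are, for both users, at least $R_0-\varepsilon$, $R_L-\varepsilon$, $R_M-\varepsilon$, and whose error probability is at most $\varepsilon$ for each user and each of the above interference configurations. Theorem. Let $R_0,R_L\ge 0$ and consider the inequalities \begin{align} M R_L+(M-L)R_0 &\le M\bigl((M-L)(\max(1-\alpha,0)+\max(1,\alpha))+(2L-M)\max(\alpha,1-\alpha)\bigr)n, \tag{a}\\ R_L+R_0 &\le Mn, \tag{b}\\ 2R_L+R_0 &\le M\bigl(\max(1,\alpha)+\max(1-\alpha,0)\bigr)n. \tag{c} \end{align} If (a), (b) and (c) all hold, then $(R_0,R_L,0)$ is achievable (inner bound). Conversely, if $(R_0,R_L,0)$ is achievable, then (a) and (b) hold (outer bounds). -/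

import Mathlib

namespace BurstyIC

/-- The `q × q` (downward) shift matrix `G` of the linear deterministic model:
`(G x)_0 = 0` and `(G x)_{l+1} = x_l`, level `0` being the top (most significant) level. -/
def shiftMatrix (F : Type*) [Field F] (q : ℕ) : Matrix (Fin q) (Fin q) F :=
  Matrix.of fun r c => if (r : ℕ) = (c : ℕ) + 1 then 1 else 0

/-- Signals of one user over `N` channel uses and `M` subcarriers, with `q = max n k` levels:
`x t j` is the vector in `F^q` on subcarrier `j` at time `t`. -/
abbrev Signal (F : Type*) (n k M N : ℕ) : Type _ :=
  Fin N → Fin M → Fin (max n k) → F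

/-- Received signal of a user whose transmitter sends `x` while the other transmitter sends `x'`,
when `S` is the set of interfered subcarriers of this user (constant over the block):
`G^(q-n) x + G^(q-k) x'` on the subcarriers in `S` and `G^(q-n) x` on the others. -/
def received {F : Type*} [Field F] {n k M N : ℕ} (S : Finset (Fin M))
    (x x' : Signal F n k M N) : Signal F n k M N :=
  fun t j =>
    if j ∈ S then
      (shiftMatrix F (max n k) ^ (max n k - n)).mulVec (x t j)
        + (shiftMatrix F (max n k) ^ (max n k - k)).mulVec (x' t j)
    else
      (shiftMatrix F (max n k) ^ (max n k - n)).mulVec (x t j)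

/-- A block code of length `N`. The two users are indexed by `Fin 2`; each has a message triple
`(W_0, W_L, W_M)` from `Fin m0 × Fin mL × Fin mM`. The encoders do not know the interference
configurations; each receiver knows its own configuration. -/
structure Code (F : Type*) (n k M N m0 mL mM : ℕ) where
  /-- encoder of each user -/
  enc : Fin 2 → Fin m0 × Fin mL × Fin mM → Signal F n k M N
  /-- decoder of `W_M`, used when all subcarriers of the user are interfered -/
  decM : Fin 2 → Signal F n k M N → Fin mM
  /-- decoder of `(W_L, W_M)`, used when exactly the given set of subcarriers is interfered -/
  decL : Fin 2 → Finset (Fin M) → Signal F n k M N → Fin mL × Fin mM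
  /-- decoder of `(W_0, W_L, W_M)`, used when no subcarrier of the user is interfered -/
  dec0 : Fin 2 → Signal F n k M N → Fin m0 × Fin mL × Fin mM

/-- Probability of an event for the uniform distribution on a finite type. -/
noncomputable def uniformProb {Ω : Type*} [Fintype Ω] (E : Set Ω) : ℝ :=
  (E.ncard : ℝ) / (Fintype.card Ω : ℝ)

namespace Code

variable {F : Type*} [Field F] {n k M N m0 mL mM : ℕ}

/-- What user `i` receives in configuration `S` when `w` is the pair of message triples;
`i.rev` is the other user. -/
def output (C : Code F n k M N m0 mL mM) (i : Fin 2) (S : Finset (Fin M))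
    (w : Fin 2 → Fin m0 × Fin mL × Fin mM) : Signal F n k M N :=
  received S (C.enc i (w i)) (C.enc i.rev (w i.rev))

/-- Error probability of user `i` when all its subcarriers are interfered; all the messages of
both users are independent and uniform, here and below. -/
noncomputable def errM (C : Code F n k M N m0 mL mM) (i : Fin 2) : ℝ :=
  uniformProb {w : Fin 2 → Fin m0 × Fin mL × Fin mM |
    C.decM i (C.output i Finset.univ w) ≠ (w i).2.2}

/-- Error probability of user `i` when exactly the subcarriers in `S` are interfered
(to be used for `S` of cardinality `L`). -/
noncomputable def errL (C : Code F n k M N m0 mL mM) (i : Fin 2) (S : Finset (Fin M)) : ℝ :=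
  uniformProb {w : Fin 2 → Fin m0 × Fin mL × Fin mM |
    C.decL i S (C.output i S w) ≠ (w i).2}

/-- Error probability of user `i` when none of its subcarriers is interfered. -/
noncomputable def err0 (C : Code F n k M N m0 mL mM) (i : Fin 2) : ℝ :=
  uniformProb {w : Fin 2 → Fin m0 × Fin mL × Fin mM |
    C.dec0 i (C.output i ∅ w) ≠ w i}

end Code

/-- Achievability of the (symmetric) rate tuple `(R0, RL, RM)`, in symbols of `F` per channel use:
for each `ε > 0` and all large `N` there is a code of length `N` whose messages have rates at least
`R0 - ε`, `RL - ε`, `RM - ε`, and all of whose error probabilities, for both users and for every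
admissible configuration, are at most `ε`. -/
def Achievable (F : Type*) [Field F] [Fintype F] (n k M L : ℕ) (R0 RL RM : ℝ) : Prop :=
  ∀ ε : ℝ, 0 < ε → ∃ N₀ : ℕ, ∀ N : ℕ, N₀ ≤ N →
    ∃ (m0 mL mM : ℕ) (C : Code F n k M N m0 mL mM),
      (Fintype.card F : ℝ) ^ ((N : ℝ) * (R0 - ε)) ≤ (m0 : ℝ) ∧
      (Fintype.card F : ℝ) ^ ((N : ℝ) * (RL - ε)) ≤ (mL : ℝ) ∧
      (Fintype.card F : ℝ) ^ ((N : ℝ) * (RM - ε)) ≤ (mM : ℝ) ∧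
      ∀ i : Fin 2,
        C.errM i ≤ ε ∧
        (∀ S : Finset (Fin M), S.card = L → C.errL i S ≤ ε) ∧
        C.err0 i ≤ ε

end BurstyIC

namespace BurstyIC

open Finset

/-! Converse. Entropies are taken over the uniform space of all message pairs, so that entropy
inequalities become inequalities about partitions. For (a), fix a user and a cyclic window of M - L
subcarriers, and let the interfered set S be its complement. Fano's inequality bounds H(W_L, Y) by
H(Y) up to small terms. By submodularity H(W_L, Y) is at least the entropy of W_L together with the
own signal on the window, plus the entropy of the interfering signal on S (`entropy_add_cross_le`).
Averaged over the windows, the first term is controlled by a Shearer inequality and yields (M - L)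
log m0 (`le_sum_entropy_window`). In the other direction, H(Y) is at most the entropy of the signal
the user itself inflicts on the other receiver, on a window of L subcarriers, plus a count of rows
this signal leaves undetermined (`entropy_output_le`). Complements of cyclic windows are again
cyclic windows, so after adding the two users the cross entropies cancel (`sum_bound`), which leaves
(a). Bound (b) is Fano's inequality without interference (`total_bound`).

Achievability. The region is covered by segments between corner points, each attained by an
error-free code, and `IsCorner.achievable` time-shares between their endpoints. There are two kinds
of codes. Level codes (`ZeroError.of_levels`) put W_L uncoded on levels that interference never
reaches; the remaining active levels carry either W_0, useful only without interference, or W_L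
protected by an MDS code across subcarriers. Pair codes (`ZeroError.of_pair`) let the users
alternate between two asymmetric roles; one of them repeats some symbols so that the other receiver
can cancel them. -/

/-- The number of points on which `f` takes the same value as at `ω`. -/
noncomputable def fiberCard {Ω β : Type*} [Fintype Ω] (f : Ω → β) (ω : Ω) : ℕ := by
  classical exact #{v | f v = f ω}

/-- Shannon entropy (in nats) of a function of a uniform random variable. -/
noncomputable def entropy {Ω β : Type*} [Fintype Ω] (f : Ω → β) : ℝ :=
  (∑ ω, (Real.log (Fintype.card Ω) - Real.log (fiberCard f ω))) / Fintype.card Ω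

/-! ### Entropy of functions on a finite uniform space -/

section Entropy

variable {Ω β γ δ κ : Type*} [Fintype Ω]

theorem fiberCard_pos (f : Ω → β) (ω : Ω) : 0 < fiberCard f ω := by
  classical
  exact Finset.card_pos.2 ⟨ω, by simp⟩

theorem fiberCard_mono {f : Ω → β} {g : Ω → γ} (h : ∀ v w, g v = g w → f v = f w) (ω : Ω) :
    fiberCard g ω ≤ fiberCard f ω := by
  classical
  refine Finset.card_le_card fun v hv => ?_
  simp only [mem_filter, mem_univ, true_and] at hv ⊢
  exact h _ _ hv

theorem entropy_mono {f : Ω → β} {g : Ω → γ} (h : ∀ v w, g v = g w → f v = f w) :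
    entropy f ≤ entropy g := by
  unfold entropy
  gcongr with ω
  · exact_mod_cast fiberCard_pos g ω
  · exact fiberCard_mono h ω

theorem entropy_congr {f : Ω → β} {g : Ω → γ} (h : ∀ v w, g v = g w ↔ f v = f w) :
    entropy f = entropy g :=
  le_antisymm (entropy_mono fun v w => (h v w).1) (entropy_mono fun v w => (h v w).2)

/-- The product of the f- and g-fibre sizes counts pairs (a, b). For a fixed pair, the ω counted
form one cell of the joint partition or none, so together they contribute at most 1 / |p-fibre of
a|, and nothing unless p a = p b. Summing over b gives at most 1 for each a. This is the
normalisation behind nonnegativity of conditional mutual information. -/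
theorem sum_fiberCard_mul_div_le {f : Ω → β} {g : Ω → γ} {p : Ω → δ}
    (hf : ∀ v w, f v = f w → p v = p w) (hg : ∀ v w, g v = g w → p v = p w) :
    ∑ ω, ((fiberCard f ω : ℝ) * fiberCard g ω) /
      ((fiberCard (fun v => (f v, g v)) ω : ℝ) * fiberCard p ω) ≤ Fintype.card Ω := by
  classical
  have h1 : ∀ ω, ((fiberCard f ω : ℝ) * fiberCard g ω) /
      ((fiberCard (fun v => (f v, g v)) ω : ℝ) * fiberCard p ω) =
      ∑ a, ∑ b, if f a = f ω ∧ g b = g ω then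
        ((fiberCard (fun v => (f v, g v)) ω : ℝ) * fiberCard p ω)⁻¹ else 0 := by
    intro ω
    have : ((fiberCard f ω : ℝ) * fiberCard g ω) =
        ∑ a, ∑ b, if f a = f ω ∧ g b = g ω then (1 : ℝ) else 0 := by
      simp only [fiberCard, Finset.card_filter, Nat.cast_sum, Finset.sum_mul_sum]
      refine Finset.sum_congr rfl fun a _ => Finset.sum_congr rfl fun b _ => ?_
      by_cases ha : f a = f ω <;> by_cases hb : g b = g ω <;> simp [ha, hb]
    rw [this, div_eq_mul_inv, Finset.sum_mul]
    refine Finset.sum_congr rfl fun a _ => ?_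
    rw [Finset.sum_mul]
    refine Finset.sum_congr rfl fun b _ => ?_
    split_ifs <;> simp
  simp only [h1]
  rw [Finset.sum_comm]
  have h2 : ∀ a : Ω, (∑ ω, ∑ b, if f a = f ω ∧ g b = g ω then
        ((fiberCard (fun v => (f v, g v)) ω : ℝ) * fiberCard p ω)⁻¹ else 0) ≤ 1 := by
    intro a
    rw [Finset.sum_comm]
    have h3 : ∀ b : Ω, (∑ ω, if f a = f ω ∧ g b = g ω then
        ((fiberCard (fun v => (f v, g v)) ω : ℝ) * fiberCard p ω)⁻¹ else 0) ≤
        if p b = p a then ((fiberCard p a : ℝ))⁻¹ else 0 := by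
      intro b
      rw [← Finset.sum_filter]
      set s : Finset Ω := {ω | f a = f ω ∧ g b = g ω} with hs
      rcases s.eq_empty_or_nonempty with he | ⟨ω₀, h₀⟩
      · rw [he, Finset.sum_empty]; split_ifs <;> positivity
      · have h₀' : f a = f ω₀ ∧ g b = g ω₀ := by simpa [hs] using h₀
        have hpa : p a = p ω₀ := hf _ _ h₀'.1
        have hpb : p b = p ω₀ := hg _ _ h₀'.2
        rw [if_pos (hpb.trans hpa.symm)]
        have hc : ∀ ω ∈ s, ((fiberCard (fun v => (f v, g v)) ω : ℝ) * fiberCard p ω)⁻¹ =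
            ((#s : ℝ) * fiberCard p a)⁻¹ := by
          intro ω hω
          have hω' : f a = f ω ∧ g b = g ω := by simpa [hs] using hω
          have e1 : fiberCard (fun v => (f v, g v)) ω = #s := by
            unfold fiberCard
            congr 1
            ext v
            simp only [hs, mem_filter, mem_univ, true_and, Prod.mk.injEq, hω'.1, hω'.2]
            constructor <;> rintro ⟨h, h'⟩ <;> exact ⟨h.symm, h'.symm⟩
          have e2 : fiberCard p ω = fiberCard p a := by
            unfold fiberCard
            rw [← hf _ _ hω'.1]
          rw [e1, e2]
        rw [Finset.sum_congr rfl hc, Finset.sum_const, nsmul_eq_mul, mul_inv, ← mul_assoc,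
          mul_inv_cancel₀, one_mul]
        have : 0 < #s := Finset.card_pos.2 ⟨ω₀, h₀⟩
        positivity
    refine (Finset.sum_le_sum fun b _ => h3 b).trans ?_
    rw [← Finset.sum_filter, Finset.sum_const, nsmul_eq_mul]
    have : #{b | p b = p a} = fiberCard p a := rfl
    rw [this, mul_inv_cancel₀]
    exact_mod_cast (fiberCard_pos p a).ne'
  calc _ = ∑ a, ∑ ω, ∑ b, _ := rfl
    _ ≤ ∑ _a : Ω, (1 : ℝ) := Finset.sum_le_sum fun a _ => h2 a
    _ = _ := by simp

/-- Submodularity of entropy, in terms of the partitions defined by the functions. -/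
theorem entropy_submodular {f : Ω → β} {g : Ω → γ} {p : Ω → δ} {u : Ω → κ}
    (hf : ∀ v w, f v = f w → p v = p w) (hg : ∀ v w, g v = g w → p v = p w)
    (hu : ∀ v w, f v = f w → g v = g w → u v = u w) :
    entropy u + entropy p ≤ entropy f + entropy g := by
  have hu' : entropy u ≤ entropy (fun v => (f v, g v)) :=
    entropy_mono fun v w h => hu v w (congrArg Prod.fst h) (congrArg Prod.snd h)
  refine (add_le_add_left hu' _).trans ?_
  unfold entropy
  rw [← add_div, ← add_div, ← Finset.sum_add_distrib, ← Finset.sum_add_distrib]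
  gcongr ?_ / _
  rw [← sub_nonpos, ← Finset.sum_sub_distrib]
  -- Pointwise log x ≤ x - 1, with x the ratio whose sum was just bounded by |Ω|.
  have key : ∀ ω : Ω, (Real.log (Fintype.card Ω) - Real.log (fiberCard (fun v => (f v, g v)) ω) +
      (Real.log (Fintype.card Ω) - Real.log (fiberCard p ω))) -
      (Real.log (Fintype.card Ω) - Real.log (fiberCard f ω) +
      (Real.log (Fintype.card Ω) - Real.log (fiberCard g ω))) ≤
      ((fiberCard f ω : ℝ) * fiberCard g ω) /
      ((fiberCard (fun v => (f v, g v)) ω : ℝ) * fiberCard p ω) - 1 := by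
    intro ω
    have h1 : (0 : ℝ) < fiberCard f ω := by exact_mod_cast fiberCard_pos f ω
    have h2 : (0 : ℝ) < fiberCard g ω := by exact_mod_cast fiberCard_pos g ω
    have h3 : (0 : ℝ) < fiberCard p ω := by exact_mod_cast fiberCard_pos p ω
    have h4 : (0 : ℝ) < fiberCard (fun v => (f v, g v)) ω := by
      exact_mod_cast fiberCard_pos (fun v => (f v, g v)) ω
    have := Real.log_le_sub_one_of_pos (x := ((fiberCard f ω : ℝ) * fiberCard g ω) /
      ((fiberCard (fun v => (f v, g v)) ω : ℝ) * fiberCard p ω)) (by positivity)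
    rw [Real.log_div (by positivity) (by positivity), Real.log_mul h1.ne' h2.ne',
      Real.log_mul h4.ne' h3.ne'] at this
    linarith
  refine (Finset.sum_le_sum fun ω _ => key ω).trans ?_
  rw [Finset.sum_sub_distrib]
  have := sum_fiberCard_mul_div_le hf hg
  simp only [Finset.sum_const, Finset.card_univ, nsmul_eq_mul, mul_one]
  linarith

theorem entropy_eq_log_div [Nonempty Ω] {f : Ω → β} {c : ℕ} (h : ∀ ω, fiberCard f ω = c) :
    entropy f = Real.log (Fintype.card Ω / c) := by
  have hc : 0 < c := by
    obtain ⟨ω⟩ := ‹Nonempty Ω›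
    exact h ω ▸ fiberCard_pos f ω
  have hΩ : (Fintype.card Ω : ℝ) ≠ 0 := by exact_mod_cast Fintype.card_ne_zero
  unfold entropy
  simp only [h, Finset.sum_const, Finset.card_univ, nsmul_eq_mul]
  rw [Real.log_div hΩ (by exact_mod_cast hc.ne')]
  field_simp

theorem entropy_const [Nonempty Ω] (b : β) : entropy (fun _ : Ω => b) = 0 := by
  classical
  rw [entropy_eq_log_div (c := Fintype.card Ω) (fun ω => by simp [fiberCard]), div_self, Real.log_one]
  exact_mod_cast Fintype.card_ne_zero

theorem entropy_le_add [Nonempty Ω] {f : Ω → β} {g : Ω → γ} {u : Ω → κ}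
    (hu : ∀ v w, f v = f w → g v = g w → u v = u w) :
    entropy u ≤ entropy f + entropy g := by
  have := entropy_submodular (p := fun _ : Ω => ()) (f := f) (g := g) (fun _ _ _ => rfl)
    (fun _ _ _ => rfl) hu
  rwa [entropy_const, add_zero] at this

/-- Gibbs' inequality. -/
theorem entropy_le_sum_neg_log [Nonempty Ω] [Fintype β] (f : Ω → β) (q : β → ℝ) (hq : ∀ b, 0 < q b)
    (hq1 : ∑ b, q b ≤ 1) :
    entropy f ≤ (∑ ω, - Real.log (q (f ω))) / Fintype.card Ω := by
  classical
  have hΩ : (0 : ℝ) < Fintype.card Ω := by exact_mod_cast Fintype.card_pos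
  unfold entropy
  gcongr ?_ / _
  rw [← sub_nonpos, ← Finset.sum_sub_distrib]
  have key : ∀ ω : Ω, (Real.log (Fintype.card Ω) - Real.log (fiberCard f ω)) -
      - Real.log (q (f ω)) ≤ Fintype.card Ω * (q (f ω) / fiberCard f ω) - 1 := by
    intro ω
    have h1 : (0 : ℝ) < fiberCard f ω := by exact_mod_cast fiberCard_pos f ω
    have h2 := hq (f ω)
    have := Real.log_le_sub_one_of_pos (x := Fintype.card Ω * (q (f ω) / fiberCard f ω))
      (by positivity)
    rw [Real.log_mul hΩ.ne' (by positivity), Real.log_div h2.ne' h1.ne'] at this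
    linarith
  refine (Finset.sum_le_sum fun ω _ => key ω).trans ?_
  rw [Finset.sum_sub_distrib, ← Finset.mul_sum]
  have h3 : ∑ ω, q (f ω) / fiberCard f ω ≤ 1 := by
    rw [← Finset.sum_fiberwise Finset.univ f]
    refine le_trans (Finset.sum_le_sum fun b _ => ?_) hq1
    rcases (Finset.univ.filter fun ω => f ω = b).eq_empty_or_nonempty with he | ⟨ω₀, h₀⟩
    · rw [he]; simpa using (hq b).le
    · have hc : ∀ ω ∈ Finset.univ.filter (fun ω => f ω = b), q (f ω) / fiberCard f ω =
          q b / #(Finset.univ.filter fun ω => f ω = b) := by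
        intro ω hω
        have : f ω = b := by simpa using hω
        simp only [fiberCard, this]
      rw [Finset.sum_congr rfl hc, Finset.sum_const, nsmul_eq_mul, mul_div_cancel₀]
      have : 0 < #(Finset.univ.filter fun ω => f ω = b) := Finset.card_pos.2 ⟨ω₀, h₀⟩
      positivity
  simp only [Finset.sum_const, Finset.card_univ, nsmul_eq_mul, mul_one]
  nlinarith

theorem entropy_le_log_card [Nonempty Ω] [Fintype β] (f : Ω → β) :
    entropy f ≤ Real.log (Fintype.card β) := by
  obtain ⟨ω⟩ := ‹Nonempty Ω›
  have hb : (0 : ℝ) < Fintype.card β := by exact_mod_cast Fintype.card_pos_iff.2 ⟨f ω⟩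
  have hΩ : (0 : ℝ) < Fintype.card Ω := by exact_mod_cast Fintype.card_pos_iff.2 ⟨ω⟩
  have : Nonempty Ω := ⟨ω⟩
  have := entropy_le_sum_neg_log f (fun _ => (Fintype.card β : ℝ)⁻¹) (fun _ => by positivity)
    (by simp [hb.ne'])
  simpa [hΩ.ne'] using this

/-- Fano's inequality. -/
theorem entropy_pair_le_of_decoder [Nonempty Ω] [Fintype β] (W : Ω → β) (Y : Ω → γ) (dec : γ → β)
    {ε : ℝ} (hε : uniformProb {ω | dec (Y ω) ≠ W ω} ≤ ε) :
    entropy (fun ω => (W ω, Y ω)) ≤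
      entropy Y + (Real.log 2 + ε * Real.log (Fintype.card β)) := by
  classical
  -- Z records the true message only when decoding fails, so Y and Z together determine W.
  set Z : Ω → Option β := fun ω => if dec (Y ω) = W ω then none else some (W ω) with hZ
  have hΩ : (0 : ℝ) < Fintype.card Ω := by exact_mod_cast Fintype.card_pos
  have hb : 0 < Fintype.card β := by
    obtain ⟨ω⟩ := ‹Nonempty Ω›
    exact Fintype.card_pos_iff.2 ⟨W ω⟩
  have hb' : (1 : ℝ) ≤ Fintype.card β := by exact_mod_cast hb
  have h1 : entropy (fun ω => (W ω, Y ω)) ≤ entropy Y + entropy Z := by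
    refine entropy_le_add fun v w hY hZ' => ?_
    simp only [hZ] at hZ'
    rw [hY] at hZ'
    split_ifs at hZ' with h h' h'
    · rw [← h, ← h', hY]
    · rw [Option.some.inj hZ', hY]
  refine h1.trans (add_le_add le_rfl ?_)
  -- Reference distribution: mass 1/2 on success, the other 1/2 spread evenly over the messages. It
  -- costs log 2 always and log |β| more on an error.
  have h2 := entropy_le_sum_neg_log Z
    (fun o => o.elim (1 / 2) (fun _ => 1 / 2 * (Fintype.card β : ℝ)⁻¹))
    (fun o => by cases o <;> (simp; try positivity))
    (by
      rw [Fintype.sum_option]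
      simp only [Option.elim, Finset.sum_const, Finset.card_univ, nsmul_eq_mul]
      field_simp
      norm_num)
  refine h2.trans ?_
  have h3 : ∀ ω, - Real.log ((Z ω).elim (1 / 2) (fun _ => 1 / 2 * (Fintype.card β : ℝ)⁻¹)) =
      Real.log 2 + if dec (Y ω) ≠ W ω then Real.log (Fintype.card β) else 0 := by
    intro ω
    by_cases h : dec (Y ω) = W ω
    · simp [hZ, h]
    · simp only [hZ, h, if_false, Option.elim, ne_eq, not_false_eq_true, if_true]
      rw [Real.log_mul (by norm_num) (by positivity), Real.log_inv, one_div, Real.log_inv]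
      ring
  simp only [h3]
  rw [Finset.sum_add_distrib, ← Finset.sum_filter, Finset.sum_const, Finset.sum_const,
    Finset.card_univ, nsmul_eq_mul, nsmul_eq_mul, add_div, mul_div_cancel_left₀ _ hΩ.ne']
  gcongr
  rw [mul_div_right_comm]
  refine mul_le_mul_of_nonneg_right ?_ (Real.log_nonneg hb')
  rw [uniformProb, Set.ncard_eq_toFinset_card'] at hε
  simpa using hε

end Entropy

/-! ### Averaging submodular functions -/

/-- A form of Shearer's lemma for submodular set functions. -/
theorem sum_sub_le_of_submodular {M : ℕ} {h : Finset (Fin M) → ℝ}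
    (hs : ∀ A B, h (A ∪ B) + h (A ∩ B) ≤ h A + h B)
    {ι : Type*} [Fintype ι] (A : ι → Finset (Fin M)) (a : ℕ)
    (ha : ∀ j, #{s | j ∈ A s} = a) :
    a * (h univ - h ∅) ≤ ∑ s, (h (A s) - h ∅) := by
  set I : ℕ → Finset (Fin M) := fun i => {j | (j : ℕ) < i} with hI
  have hIz : I 0 = ∅ := by ext; simp [hI]
  have hIM : I M = univ := by ext j; simp [hI]
  -- Diminishing returns along the chain of initial segments: adding i to the smaller set B ∩ I i
  -- gains at least as much as adding it to I i. The gains telescope.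
  have step : ∀ (B : Finset (Fin M)) (i : Fin M),
      (if i ∈ B then h (I (i + 1)) - h (I i) else 0) ≤ h (B ∩ I (i + 1)) - h (B ∩ I i) := by
    intro B i
    split_ifs with hi
    · have h1 := hs (B ∩ I (i + 1)) (I i)
      have e1 : B ∩ I (i + 1) ∪ I i = I (i + 1) := by
        ext j
        simp only [hI, mem_union, mem_inter, mem_filter, mem_univ, true_and]
        constructor
        · rintro (h | h) <;> omega
        · intro h
          rcases Nat.lt_succ_iff_lt_or_eq.1 h with h | h
          · exact Or.inr h
          · exact Or.inl ⟨(Fin.ext h : j = i) ▸ hi, by omega⟩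
      have e2 : B ∩ I (i + 1) ∩ I i = B ∩ I i := by
        ext j
        simp only [hI, mem_inter, mem_filter, mem_univ, true_and]
        constructor
        · rintro ⟨⟨h, _⟩, h'⟩; exact ⟨h, h'⟩
        · rintro ⟨h, h'⟩; exact ⟨⟨h, by omega⟩, h'⟩
      rw [e1, e2] at h1
      linarith
    · have : B ∩ I (i + 1) = B ∩ I i := by
        ext j
        simp only [hI, mem_inter, mem_filter, mem_univ, true_and, and_congr_right_iff]
        intro hj
        have : (j : ℕ) ≠ i := fun h => hi ((Fin.ext h : j = i) ▸ hj)
        omega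
      rw [this, sub_self]
  have tele : ∀ B : Finset (Fin M),
      ∑ i : Fin M, (if i ∈ B then h (I (i + 1)) - h (I i) else 0) ≤ h B - h ∅ := by
    intro B
    refine (Finset.sum_le_sum fun i _ => step B i).trans_eq ?_
    rw [Fin.sum_univ_eq_sum_range (fun i => h (B ∩ I (i + 1)) - h (B ∩ I i)) M,
      Finset.sum_range_sub (fun i => h (B ∩ I i)), hIz, hIM, inter_univ, inter_empty]
  refine le_trans (le_of_eq ?_) (Finset.sum_le_sum fun s _ => tele (A s))
  rw [Finset.sum_comm]
  have : ∀ i : Fin M, ∑ s, (if i ∈ A s then h (I (i + 1)) - h (I i) else 0) =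
      a * (h (I (i + 1)) - h (I i)) := by
    intro i
    rw [← Finset.sum_filter, Finset.sum_const, ha, nsmul_eq_mul]
  simp only [this]
  rw [← Finset.mul_sum, Fin.sum_univ_eq_sum_range (fun i => h (I (i + 1)) - h (I i)) M,
      Finset.sum_range_sub (fun i => h (I i)), hIz, hIM]

/-! ### Shifts, direct and cross signals -/

section Signals

variable {F : Type*} [Field F]

/-- Extension of a vector by zero to all indices. -/
def extendZero {q : ℕ} (v : Fin q → F) (l : ℕ) : F :=
  if h : l < q then v ⟨l, h⟩ else 0

theorem extendZero_val {q : ℕ} (v : Fin q → F) (r : Fin q) : extendZero v r = v r := by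
  simp [extendZero]

theorem shiftMatrix_mulVec {q : ℕ} (v : Fin q → F) (r : Fin q) :
    (shiftMatrix F q).mulVec v r = if 1 ≤ (r : ℕ) then extendZero v (r - 1) else 0 := by
  simp only [Matrix.mulVec, dotProduct, shiftMatrix, Matrix.of_apply, ite_mul, one_mul, zero_mul]
  split_ifs with h
  · have hlt : (r : ℕ) - 1 < q := by omega
    rw [Finset.sum_eq_single (⟨(r : ℕ) - 1, hlt⟩ : Fin q)]
    · simp [extendZero, hlt, Nat.sub_add_cancel h]
    · intro b _ hb
      rw [if_neg]
      intro hr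
      exact hb (Fin.ext (by simp [hr]))
    · simp
  · refine Finset.sum_eq_zero fun b _ => if_neg (by omega)

theorem shiftMatrix_pow_mulVec {q : ℕ} (e : ℕ) (v : Fin q → F) (r : Fin q) :
    (shiftMatrix F q ^ e).mulVec v r = if e ≤ (r : ℕ) then extendZero v (r - e) else 0 := by
  induction e generalizing r with
  | zero => simp [extendZero_val]
  | succ e ih =>
    rw [pow_succ', ← Matrix.mulVec_mulVec, shiftMatrix_mulVec]
    by_cases h : 1 ≤ (r : ℕ)
    · have hlt : (r : ℕ) - 1 < q := by omega
      rw [if_pos h, extendZero, dif_pos hlt, ih]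
      simp only [Nat.sub_sub, Nat.add_comm 1 e]
      by_cases h' : e + 1 ≤ (r : ℕ)
      · rw [if_pos h', if_pos (by omega)]
      · rw [if_neg h', if_neg (by omega)]
    · rw [if_neg h, if_neg (by omega)]

variable {n k M N : ℕ}

theorem received_apply (S : Finset (Fin M)) (x x' : Signal F n k M N) (t : Fin N) (j : Fin M)
    (r : Fin (max n k)) :
    received S x x' t j r =
      (if max n k - n ≤ (r : ℕ) then extendZero (x t j) (r - (max n k - n)) else 0) +
      (if j ∈ S then
        (if max n k - k ≤ (r : ℕ) then extendZero (x' t j) (r - (max n k - k)) else 0) else 0) := by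
  unfold received
  split_ifs <;> simp [*, shiftMatrix_pow_mulVec]

/-- What a receiver sees of its own transmitter in the absence of interference. -/
def direct (x : Signal F n k M N) : Signal F n k M N :=
  fun t j => (shiftMatrix F (max n k) ^ (max n k - n)).mulVec (x t j)

/-- What a receiver sees of the other transmitter. -/
def cross (x : Signal F n k M N) : Signal F n k M N :=
  fun t j => (shiftMatrix F (max n k) ^ (max n k - k)).mulVec (x t j)

/-- Restriction of a signal to a set of subcarriers. -/
def mask (A : Finset (Fin M)) (x : Signal F n k M N) : Signal F n k M N :=
  fun t j => if j ∈ A then x t j else 0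

theorem mask_apply_of_mem {A : Finset (Fin M)} {x : Signal F n k M N} {j : Fin M} (h : j ∈ A)
    (t : Fin N) : mask A x t j = x t j := if_pos h

theorem mask_eq_iff {A : Finset (Fin M)} {x y : Signal F n k M N} :
    mask A x = mask A y ↔ ∀ t, ∀ j ∈ A, x t j = y t j := by
  constructor
  · intro h t j hj
    rw [← mask_apply_of_mem (x := x) hj t, h, mask_apply_of_mem hj]
  · intro h
    funext t j
    unfold mask
    split_ifs with hj
    · exact h t j hj
    · rfl

theorem mask_univ (x : Signal F n k M N) : mask univ x = x := by
  funext t j; simp [mask]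

theorem mask_empty (x : Signal F n k M N) : mask ∅ x = 0 := by
  funext t j; simp [mask]

theorem received_eq_add (S : Finset (Fin M)) (x x' : Signal F n k M N) :
    received S x x' = direct x + mask S (cross x') := by
  funext t j
  simp only [received, direct, cross, mask, Pi.add_apply]
  split_ifs <;> simp

theorem received_empty (x x' : Signal F n k M N) : received ∅ x x' = direct x := by
  rw [received_eq_add, mask_empty, add_zero]

theorem mask_compl_received (S : Finset (Fin M)) (x x' : Signal F n k M N) :
    mask Sᶜ (received S x x') = mask Sᶜ (direct x) := by
  rw [mask_eq_iff]
  intro t j hj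
  rw [mem_compl] at hj
  rw [received_eq_add]
  simp [mask, hj]

theorem extendZero_eq_of_cross_eq {x y : Signal F n k M N} {t : Fin N} {j : Fin M}
    (h : cross x t j = cross y t j) {l : ℕ} (hl : l < k) :
    extendZero (x t j) l = extendZero (y t j) l := by
  have hr : l + (max n k - k) < max n k := by omega
  have := congrFun h ⟨_, hr⟩
  simpa [cross, shiftMatrix_pow_mulVec] using this

theorem direct_apply (x : Signal F n k M N) (t : Fin N) (j : Fin M) (r : Fin (max n k)) :
    direct x t j r = if max n k - n ≤ (r : ℕ) then extendZero (x t j) (r - (max n k - n)) else 0 :=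
  shiftMatrix_pow_mulVec _ _ _

end Signals

theorem card_lower_rows_le (q c : ℕ) : Fintype.card {r : Fin q // q ≤ r + c} ≤ c := by
  have : Function.Injective (fun r : {r : Fin q // q ≤ r + c} =>
      (⟨q - 1 - r.1, by have := r.2; have := r.1.2; omega⟩ : Fin c)) := by
    intro r s h
    have h' := congrArg Fin.val h
    have h1 := r.1.2
    have h2 := s.1.2
    simp only at h'
    exact Subtype.ext (Fin.ext (by omega))
  simpa using Fintype.card_le_of_injective _ this

theorem log_card_lower_rows_le (F : Type*) [Field F] [Fintype F] (N M q : ℕ) (c : Fin M → ℕ) :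
    Real.log (Fintype.card (Fin N → (j : Fin M) → {r : Fin q // q ≤ r + c j} → F)) ≤
      N * (∑ j, (c j : ℝ)) * Real.log (Fintype.card F) := by
  classical
  have hF : (1 : ℝ) ≤ Fintype.card F := by exact_mod_cast Fintype.card_pos
  simp only [Fintype.card_fun, Fintype.card_fin, Fintype.card_pi, Finset.prod_pow_eq_pow_sum]
  push_cast
  rw [← pow_mul, Real.log_pow]
  refine mul_le_mul_of_nonneg_right ?_ (Real.log_nonneg hF)
  rw [mul_comm]
  push_cast
  gcongr with j
  exact card_lower_rows_le _ _

/-! ### Cyclic windows of subcarriers -/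

section Windows

variable {M : ℕ}

/-- The cyclic window of `a` consecutive subcarriers starting at `s`. -/
def window (a : ℕ) (s : Fin M) : Finset (Fin M) := {j | ((j - s : Fin M) : ℕ) < a}

theorem mem_window {a : ℕ} {s j : Fin M} : j ∈ window a s ↔ ((j - s : Fin M) : ℕ) < a := by
  simp [window]

theorem card_fin_val_lt {a : ℕ} (ha : a ≤ M) : #{y : Fin M | (y : ℕ) < a} = a := by
  rw [Fin.card_filter_val_lt, min_eq_right ha]

variable [NeZero M]

theorem card_window {a : ℕ} (ha : a ≤ M) (s : Fin M) : #(window a s) = a := by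
  exact (Finset.card_equiv (t := {y : Fin M | (y : ℕ) < a}) (Equiv.subRight s)
    (by simp [mem_window])).trans (card_fin_val_lt ha)

theorem card_filter_mem_window {a : ℕ} (ha : a ≤ M) (j : Fin M) : #{s | j ∈ window a s} = a := by
  exact (Finset.card_equiv (t := {y : Fin M | (y : ℕ) < a}) (Equiv.subLeft j)
    (by simp [mem_window])).trans (card_fin_val_lt ha)

/-- Cyclicity matters here: the interfered sets are translates of the windows on which the cross
signals are measured, so sums over all starting points agree. -/
theorem compl_window_eq {L : ℕ} (hL : 1 ≤ L) (hLM : L ≤ M) (s : Fin M) :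
    (window (M - L) s)ᶜ = window L (s + Fin.ofNat M (M - L)) := by
  ext j
  rw [mem_compl, mem_window, mem_window, ← sub_sub]
  generalize j - s = y
  have hy := y.2
  rw [Fin.sub_def]
  simp only [Fin.val_ofNat, Nat.mod_eq_of_lt (show M - L < M by omega)]
  by_cases h : (y : ℕ) < M - L
  · rw [Nat.mod_eq_of_lt (by omega)]; omega
  · rw [Nat.mod_eq_sub_mod (by omega), Nat.mod_eq_of_lt (by omega)]; omega

theorem sum_sub_window (s : Fin M) (f : ℕ → ℝ) :
    ∑ j : Fin M, f ((j - s : Fin M) : ℕ) = ∑ y ∈ range M, f y := by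
  rw [← Fin.sum_univ_eq_sum_range]
  exact Equiv.sum_comp (Equiv.subRight s) (fun y : Fin M => f (y : ℕ))

end Windows

/-! ### Independence of the two users -/

section Independence

variable {T β γ : Type*} [Fintype T]

theorem card_filter_two_users (i : Fin 2) (P Q : T → Prop) [DecidablePred P] [DecidablePred Q] :
    #{w : Fin 2 → T | P (w i) ∧ Q (w i.rev)} = #{t | P t} * #{t | Q t} := by
  classical
  rw [← Finset.card_product]
  have hi : i.rev ≠ i := by fin_cases i <;> decide
  have hj : ∀ j, j ≠ i → j = i.rev := by fin_cases i <;> decide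
  let e : (Fin 2 → T) ≃ T × T :=
    { toFun := fun w => (w i, w i.rev)
      invFun := fun p j => if j = i then p.1 else p.2
      left_inv := fun w => by
        funext j
        by_cases h : j = i
        · simp [h]
        · obtain rfl := hj j h
          simp [hi]
      right_inv := fun p => by simp [hi] }
  exact Finset.card_equiv e (by simp [e])

theorem card_filter_one_user (i : Fin 2) (P : T → Prop) [DecidablePred P] :
    #{w : Fin 2 → T | P (w i)} = #{t | P t} * Fintype.card T := by
  have := card_filter_two_users i P (fun _ => True)
  simpa using this

theorem entropy_two_users [Nonempty T] (i : Fin 2) (f : T → β) (g : T → γ) :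
    entropy (fun w : Fin 2 → T => (f (w i), g (w i.rev))) =
      entropy (fun w : Fin 2 → T => f (w i)) + entropy (fun w : Fin 2 → T => g (w i.rev)) := by
  classical
  unfold entropy
  rw [← add_div, ← Finset.sum_add_distrib]
  congr 1
  refine Finset.sum_congr rfl fun w _ => ?_
  have hT : (0 : ℝ) < Fintype.card T := by exact_mod_cast Fintype.card_pos
  have e1 : fiberCard (fun w : Fin 2 → T => f (w i)) w =
      #{t | f t = f (w i)} * Fintype.card T := by
    unfold fiberCard
    convert card_filter_one_user i (fun t => f t = f (w i))
  have e2 : fiberCard (fun w : Fin 2 → T => g (w i.rev)) w =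
      #{t | g t = g (w i.rev)} * Fintype.card T := by
    unfold fiberCard
    convert card_filter_one_user i.rev (fun t => g t = g (w i.rev))
  have e3 : fiberCard (fun w : Fin 2 → T => (f (w i), g (w i.rev))) w =
      #{t | f t = f (w i)} * #{t | g t = g (w i.rev)} := by
    unfold fiberCard
    rw [← card_filter_two_users i (fun t => f t = f (w i)) (fun t => g t = g (w i.rev))]
    congr 1
    ext v
    simp
  have p1 : (0 : ℝ) < #{t | f t = f (w i)} := by
    exact_mod_cast Finset.card_pos.2 ⟨w i, by simp⟩
  have p2 : (0 : ℝ) < #{t | g t = g (w i.rev)} := by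
    exact_mod_cast Finset.card_pos.2 ⟨w i.rev, by simp⟩
  rw [e1, e2, e3]
  push_cast
  rw [Real.log_mul p1.ne' p2.ne', Real.log_mul p1.ne' hT.ne', Real.log_mul p2.ne' hT.ne']
  simp only [Fintype.card_fun, Fintype.card_fin]
  push_cast
  rw [Real.log_pow]
  push_cast
  ring

theorem entropy_one_user_of_card [Nonempty T] (i : Fin 2) (f : T → β) {c m : ℕ} (hm : 0 < m)
    (hc : ∀ s, Nat.card {t // f t = f s} = c) (hcm : Fintype.card T = m * c) :
    entropy (fun w : Fin 2 → T => f (w i)) = Real.log m := by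
  classical
  have hT : 0 < Fintype.card T := Fintype.card_pos
  have hc0 : 0 < c := Nat.pos_of_ne_zero fun h => by simp [h] at hcm
  rw [entropy_eq_log_div (c := c * Fintype.card T)]
  · simp only [Fintype.card_fun, Fintype.card_fin]
    rw [hcm]
    push_cast
    have h1 : (m : ℝ) ≠ 0 := by exact_mod_cast hm.ne'
    have h2 : (c : ℝ) ≠ 0 := by exact_mod_cast hc0.ne'
    congr 1
    field_simp
  · intro w
    rw [← hc (w i), Nat.card_eq_fintype_card, Fintype.card_subtype]
    unfold fiberCard
    convert card_filter_one_user i (fun t => f t = f (w i))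

end Independence

theorem uniformProb_mono {Ω : Type*} [Fintype Ω] {E E' : Set Ω} (h : E ⊆ E') :
    uniformProb E ≤ uniformProb E' := by
  unfold uniformProb
  gcongr ?_ / _
  exact_mod_cast Set.ncard_le_ncard h (Set.toFinite _)

/-! ### Entropy bounds for a single code -/

namespace Code

variable {F : Type*} [Field F] {n k M N m0 mL mM : ℕ}

section

variable (C : Code F n k M N m0 mL mM)

theorem entropy_messageL [Nonempty (Fin m0 × Fin mL × Fin mM)] (i : Fin 2) :
    entropy (fun w : Fin 2 → Fin m0 × Fin mL × Fin mM => (w i).2.1) = Real.log mL := by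
  have hmL : 0 < mL := by
    obtain ⟨t⟩ := ‹Nonempty (Fin m0 × Fin mL × Fin mM)›
    exact t.2.1.pos
  refine entropy_one_user_of_card i (fun t : Fin m0 × Fin mL × Fin mM => t.2.1)
    (c := m0 * mM) hmL (fun s => ?_) (by simp; ring)
  let e : {t : Fin m0 × Fin mL × Fin mM // t.2.1 = s.2.1} ≃ Fin m0 × Fin mM :=
    { toFun := fun t => (t.1.1, t.1.2.2)
      invFun := fun p => ⟨(p.1, s.2.1, p.2), rfl⟩
      left_inv := by rintro ⟨⟨a, b, c⟩, h⟩; simp only at h; simp [h]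
      right_inv := fun p => rfl }
  rw [Nat.card_congr e]
  simp

theorem entropy_message0L [Nonempty (Fin m0 × Fin mL × Fin mM)] (i : Fin 2) :
    entropy (fun w : Fin 2 → Fin m0 × Fin mL × Fin mM => ((w i).1, (w i).2.1)) =
      Real.log m0 + Real.log mL := by
  obtain ⟨t₀⟩ := ‹Nonempty (Fin m0 × Fin mL × Fin mM)›
  have hm0 : 0 < m0 := t₀.1.pos
  have hmL : 0 < mL := t₀.2.1.pos
  have : Nonempty (Fin m0 × Fin mL × Fin mM) := ⟨t₀⟩
  rw [← Real.log_mul (by exact_mod_cast hm0.ne') (by exact_mod_cast hmL.ne'), ← Nat.cast_mul]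
  refine entropy_one_user_of_card i (fun t : Fin m0 × Fin mL × Fin mM => (t.1, t.2.1))
    (c := mM) (by positivity) (fun s => ?_) (by simp; ring)
  let e : {t : Fin m0 × Fin mL × Fin mM // (t.1, t.2.1) = (s.1, s.2.1)} ≃ Fin mM :=
    { toFun := fun t => t.1.2.2
      invFun := fun p => ⟨(s.1, s.2.1, p), rfl⟩
      left_inv := by
        rintro ⟨⟨a, b, c⟩, h⟩
        simp only [Prod.mk.injEq] at h
        simp [h]
      right_inv := fun p => rfl }
  rw [Nat.card_congr e]
  simp

/-- The interfering signal is independent of the message of the user. -/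
theorem entropy_add_cross_le [Nonempty (Fin m0 × Fin mL × Fin mM)] (i : Fin 2)
    (S : Finset (Fin M)) :
    entropy (fun w : Fin 2 → Fin m0 × Fin mL × Fin mM =>
        ((w i).2.1, mask Sᶜ (direct (C.enc i (w i))))) +
      entropy (fun w : Fin 2 → Fin m0 × Fin mL × Fin mM => mask S (cross (C.enc i.rev (w i.rev)))) ≤
    entropy (fun w : Fin 2 → Fin m0 × Fin mL × Fin mM => ((w i).2.1, C.output i S w)) := by
  have h1 := entropy_two_users i (fun t : Fin m0 × Fin mL × Fin mM => t)
    (fun t => mask S (cross (C.enc i.rev t)))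
  -- Taking the user's entire message triple for g, the join has entropy H(w i) + H(cross signal) by
  -- independence, and H(w i) cancels.
  have h2 := entropy_submodular
    (f := fun w : Fin 2 → Fin m0 × Fin mL × Fin mM => ((w i).2.1, C.output i S w))
    (g := fun w => w i)
    (p := fun w => ((w i).2.1, mask Sᶜ (direct (C.enc i (w i)))))
    (u := fun w => (w i, mask S (cross (C.enc i.rev (w i.rev)))))
    (fun v w h => by
      simp only [Prod.mk.injEq, output] at h ⊢
      refine ⟨h.1, ?_⟩
      rw [← mask_compl_received S _ (C.enc i.rev (v i.rev)), h.2, mask_compl_received])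
    (fun v w h => by simp only [h])
    (fun v w h h' => by
      simp only [Prod.mk.injEq, output, received_eq_add] at h ⊢
      refine ⟨h', ?_⟩
      have := h.2
      rw [h'] at this
      exact add_left_cancel this)
  linarith

theorem entropy_messageL_output_le [Nonempty (Fin m0 × Fin mL × Fin mM)] (i : Fin 2)
    (S : Finset (Fin M)) {ε : ℝ} (h : C.errL i S ≤ ε) :
    entropy (fun w : Fin 2 → Fin m0 × Fin mL × Fin mM => ((w i).2.1, C.output i S w)) ≤
      entropy (C.output i S) + (Real.log 2 + ε * Real.log mL) := by
  have := entropy_pair_le_of_decoder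
    (fun w : Fin 2 → Fin m0 × Fin mL × Fin mM => (w i).2.1) (C.output i S)
    (fun y => (C.decL i S y).1) (ε := ε)
    ((uniformProb_mono fun w hw => by
      simp only [Set.mem_ofPred_eq] at hw ⊢
      exact fun h' => hw (by rw [h'])).trans h)
  rwa [Fintype.card_fin] at this

/-- Fano's inequality for W_0 alone, with W_L kept as side information. This keeps the full log mL,
which is subtracted again in the Shearer step. -/
theorem entropy_message0_direct_le [Nonempty (Fin m0 × Fin mL × Fin mM)] (i : Fin 2)
    {ε : ℝ} (h : C.err0 i ≤ ε) :
    (1 - ε) * Real.log m0 + Real.log mL - Real.log 2 ≤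
    entropy (fun w : Fin 2 → Fin m0 × Fin mL × Fin mM =>
      ((w i).2.1, direct (C.enc i (w i)))) := by
  have h1 := entropy_pair_le_of_decoder
    (fun w : Fin 2 → Fin m0 × Fin mL × Fin mM => (w i).1)
    (fun w => ((w i).2.1, direct (C.enc i (w i))))
    (fun y => (C.dec0 i y.2).1) (ε := ε)
    ((uniformProb_mono fun w hw => by
      simp only [Set.mem_ofPred_eq, output, received_empty] at hw ⊢
      exact fun h' => hw (by rw [h'])).trans h)
  have h2 : entropy (fun w : Fin 2 → Fin m0 × Fin mL × Fin mM => ((w i).1, (w i).2.1)) ≤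
      entropy (fun w : Fin 2 → Fin m0 × Fin mL × Fin mM =>
        ((w i).1, ((w i).2.1, direct (C.enc i (w i))))) :=
    entropy_mono fun v w h => by
      simp only [Prod.mk.injEq] at h ⊢
      exact ⟨h.1, h.2.1⟩
  rw [entropy_message0L] at h2
  rw [Fintype.card_fin] at h1
  linarith

theorem entropy_direct_submodular (i : Fin 2) (A B : Finset (Fin M)) :
    entropy (fun w : Fin 2 → Fin m0 × Fin mL × Fin mM =>
        ((w i).2.1, mask (A ∪ B) (direct (C.enc i (w i))))) +
      entropy (fun w : Fin 2 → Fin m0 × Fin mL × Fin mM =>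
        ((w i).2.1, mask (A ∩ B) (direct (C.enc i (w i))))) ≤
      entropy (fun w : Fin 2 → Fin m0 × Fin mL × Fin mM =>
        ((w i).2.1, mask A (direct (C.enc i (w i))))) +
      entropy (fun w : Fin 2 → Fin m0 × Fin mL × Fin mM =>
        ((w i).2.1, mask B (direct (C.enc i (w i))))) := by
  refine entropy_submodular (fun v w h => ?_) (fun v w h => ?_) (fun v w h h' => ?_) <;>
    simp only [Prod.mk.injEq, mask_eq_iff] at *
  · exact ⟨h.1, fun t j hj => h.2 t j (mem_inter.1 hj).1⟩
  · exact ⟨h.1, fun t j hj => h.2 t j (mem_inter.1 hj).2⟩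
  · exact ⟨h.1, fun t j hj => (mem_union.1 hj).elim (h.2 t j) (h'.2 t j)⟩

/-- Each subcarrier lies in exactly a of the windows, and on the empty set the entropy is that of
W_L, so Shearer's inequality applies to the increments over log mL. -/
theorem le_sum_entropy_window [Nonempty (Fin m0 × Fin mL × Fin mM)] [NeZero M] (i : Fin 2)
    {ε : ℝ} (h : C.err0 i ≤ ε) {a : ℕ} (ha : a ≤ M) :
    a * ((1 - ε) * Real.log m0 - Real.log 2) ≤
      ∑ s : Fin M, (entropy (fun w : Fin 2 → Fin m0 × Fin mL × Fin mM =>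
        ((w i).2.1, mask (window a s) (direct (C.enc i (w i))))) - Real.log mL) := by
  have h1 := sum_sub_le_of_submodular
    (h := fun A => entropy (fun w : Fin 2 → Fin m0 × Fin mL × Fin mM =>
        ((w i).2.1, mask A (direct (C.enc i (w i))))))
    (fun A B => C.entropy_direct_submodular i A B) (window a) a (card_filter_mem_window ha)
  have h2 : entropy (fun w : Fin 2 → Fin m0 × Fin mL × Fin mM =>
        ((w i).2.1, mask ∅ (direct (C.enc i (w i))))) = Real.log mL := by
    rw [← entropy_messageL (m0 := m0) (mM := mM) i]
    exact entropy_congr fun v w => by simp [mask_empty]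
  simp only [h2, mask_univ] at h1
  refine le_trans ?_ h1
  have := C.entropy_message0_direct_le i h
  exact mul_le_mul_of_nonneg_left (by linarith) (Nat.cast_nonneg _)

/-- Number of rows of the received signal that the cross signal leaves undetermined, on the
subcarrier at cyclic distance `y` from the start of the window. -/
def rowCount (n k M L y : ℕ) : ℕ :=
  if y < M - L then n - k else if y < L then max k (n - k) else max n k

/-- Since M - L ≤ L, the window of length L extends the uninterfered one, and the cross signal on it
reveals the top k own levels. At distance y < M - L only the bottom n - k rows stay unknown. For M -
L ≤ y < L the interference also spoils the bottom k rows. For y ≥ L nothing is known and every row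
is counted. -/
theorem entropy_output_le [Fintype F] [Nonempty (Fin m0 × Fin mL × Fin mM)] [NeZero M] (i : Fin 2)
    {L : ℕ} (hML : M ≤ 2 * L) (s : Fin M) :
    entropy (C.output i (window (M - L) s)ᶜ) ≤
      entropy (fun w : Fin 2 → Fin m0 × Fin mL × Fin mM =>
        mask (window L s) (cross (C.enc i (w i)))) +
      N * (∑ y ∈ range M, (rowCount n k M L y : ℝ)) * Real.log (Fintype.card F) := by
  rw [← sum_sub_window s (fun y => (rowCount n k M L y : ℝ))]
  set c : Fin M → ℕ := fun j => rowCount n k M L ((j - s : Fin M) : ℕ) with hc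
  refine le_trans (entropy_le_add
    (g := fun w t j (r : {r : Fin (max n k) // max n k ≤ r + c j}) =>
      C.output i (window (M - L) s)ᶜ w t j r.1) (fun v w h h' => ?_)) (add_le_add le_rfl
      ((entropy_le_log_card _).trans (log_card_lower_rows_le F N M (max n k) c)))
  funext t j r
  by_cases hr : max n k ≤ r + c j
  · exact congrFun (congrFun (congrFun h' t) j) ⟨r, hr⟩
  · rw [mask_eq_iff] at h
    have h := h t j
    simp only [hc, rowCount] at hr
    simp only [output, received_apply, mem_compl, mem_window] at h ⊢
    generalize ((j - s : Fin M) : ℕ) = y at *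
    have hrq := r.2
    by_cases h1 : y < M - L
    · rw [if_pos h1] at hr
      simp only [h1, not_true_eq_false, if_false, add_zero]
      have hcr := h (by omega)
      split_ifs
      · exact extendZero_eq_of_cross_eq hcr (by omega)
      · rfl
    · rw [if_neg h1] at hr
      by_cases h2 : y < L
      · rw [if_pos h2] at hr
        have hcr := h h2
        rw [if_neg (show ¬ max n k - k ≤ (r : ℕ) by omega),
          if_neg (show ¬ max n k - k ≤ (r : ℕ) by omega)]
        congr 1
        split_ifs
        · exact extendZero_eq_of_cross_eq hcr (by omega)
        · rfl
      · rw [if_neg h2] at hr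
        omega

end

end Code

namespace Code

variable {F : Type*} [Field F] [Fintype F] {n k M N m0 mL mM : ℕ}
  [Nonempty (Fin m0 × Fin mL × Fin mM)] (C : Code F n k M N m0 mL mM)

theorem user_bound [NeZero M] (i : Fin 2) {L : ℕ} (hML : M ≤ 2 * L) (hLM : L ≤ M) {ε : ℝ}
    (h0 : C.err0 i ≤ ε) (hL : ∀ S : Finset (Fin M), #S = L → C.errL i S ≤ ε) :
    (M - L : ℕ) * ((1 - ε) * Real.log m0 - Real.log 2) + M * ((1 - ε) * Real.log mL) +
      ∑ s : Fin M, entropy (fun w : Fin 2 → Fin m0 × Fin mL × Fin mM =>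
        mask (window L s) (cross (C.enc i.rev (w i.rev)))) ≤
    ∑ s : Fin M, entropy (fun w : Fin 2 → Fin m0 × Fin mL × Fin mM =>
        mask (window L s) (cross (C.enc i (w i)))) +
      M * (N * (∑ y ∈ range M, (rowCount n k M L y : ℝ)) * Real.log (Fintype.card F)) +
      M * Real.log 2 := by
  have hM : 0 < M := Nat.pos_of_neZero M
  have hL1 : 1 ≤ L := by omega
  have h1 := C.le_sum_entropy_window i h0 (a := M - L) (by omega)
  -- Reindexing by the shift M - L puts the other user's cross entropies into the same form as the
  -- user's own.
  have h2 : ∑ s : Fin M, entropy (fun w : Fin 2 → Fin m0 × Fin mL × Fin mM =>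
        mask (window L s) (cross (C.enc i.rev (w i.rev)))) =
      ∑ s : Fin M, entropy (fun w : Fin 2 → Fin m0 × Fin mL × Fin mM =>
        mask (window (M - L) s)ᶜ (cross (C.enc i.rev (w i.rev)))) := by
    simp only [compl_window_eq hL1 hLM]
    exact (Equiv.sum_comp (Equiv.addRight (Fin.ofNat M (M - L))) (fun s : Fin M =>
      entropy (fun w : Fin 2 → Fin m0 × Fin mL × Fin mM =>
        mask (window L s) (cross (C.enc i.rev (w i.rev)))))).symm
  have h3 : ∀ s : Fin M, entropy (fun w : Fin 2 → Fin m0 × Fin mL × Fin mM =>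
        ((w i).2.1, mask (window (M - L) s) (direct (C.enc i (w i))))) - Real.log mL +
      entropy (fun w : Fin 2 → Fin m0 × Fin mL × Fin mM =>
        mask (window (M - L) s)ᶜ (cross (C.enc i.rev (w i.rev)))) ≤
      entropy (fun w : Fin 2 → Fin m0 × Fin mL × Fin mM =>
        mask (window L s) (cross (C.enc i (w i)))) +
      (N * (∑ y ∈ range M, (rowCount n k M L y : ℝ)) * Real.log (Fintype.card F) +
        Real.log 2 - (1 - ε) * Real.log mL) := by
    intro s
    have e1 := C.entropy_add_cross_le i (window (M - L) s)ᶜ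
    rw [compl_compl] at e1
    have e2 := C.entropy_messageL_output_le i (window (M - L) s)ᶜ
      (hL _ (by rw [card_compl, card_window (by omega), Fintype.card_fin]; omega))
    have e3 := C.entropy_output_le i hML s
    linarith
  have h4 := Finset.sum_le_sum fun s (_ : s ∈ (univ : Finset (Fin M))) => h3 s
  rw [Finset.sum_add_distrib, Finset.sum_add_distrib, Finset.sum_const, Finset.card_univ,
    Fintype.card_fin, nsmul_eq_mul] at h4
  rw [h2]
  linarith

/-- Each user's cross entropies stand on the left of one `user_bound` and on the right of the other,
so they vanish on addition. -/
theorem sum_bound [NeZero M] {L : ℕ} (hML : M ≤ 2 * L) (hLM : L ≤ M) {ε : ℝ}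
    (h0 : ∀ i, C.err0 i ≤ ε) (hL : ∀ i, ∀ S : Finset (Fin M), #S = L → C.errL i S ≤ ε) :
    (1 - ε) * (M * Real.log mL + (M - L : ℕ) * Real.log m0) ≤
      M * (N * (∑ y ∈ range M, (rowCount n k M L y : ℝ)) * Real.log (Fintype.card F)) +
      (M + (M - L : ℕ)) * Real.log 2 := by
  have u0 := C.user_bound 0 hML hLM (h0 0) (hL 0)
  have u1 := C.user_bound 1 hML hLM (h0 1) (hL 1)
  have r0 : Fin.rev (0 : Fin 2) = 1 := rfl
  have r1 : Fin.rev (1 : Fin 2) = 0 := rfl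
  rw [r0] at u0
  rw [r1] at u1
  linarith

/-- Without interference only the bottom n rows of each subcarrier can be nonzero; Fano's inequality
is applied to (W_0, W_L) jointly. -/
theorem total_bound (i : Fin 2) {ε : ℝ} (h0 : C.err0 i ≤ ε) :
    (1 - ε) * (Real.log mL + Real.log m0) ≤
      N * (M * n) * Real.log (Fintype.card F) + Real.log 2 := by
  have hm0 : 0 < m0 := (Classical.arbitrary (Fin m0 × Fin mL × Fin mM)).1.pos
  have hmL : 0 < mL := (Classical.arbitrary (Fin m0 × Fin mL × Fin mM)).2.1.pos
  have h1 := entropy_pair_le_of_decoder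
    (fun w : Fin 2 → Fin m0 × Fin mL × Fin mM => ((w i).1, (w i).2.1))
    (fun w => direct (C.enc i (w i)))
    (fun y => ((C.dec0 i y).1, (C.dec0 i y).2.1)) (ε := ε)
    ((uniformProb_mono fun w hw => by
      simp only [Set.mem_ofPred_eq, output, received_empty] at hw ⊢
      exact fun h' => hw (by rw [h'])).trans h0)
  have h2 : entropy (fun w : Fin 2 → Fin m0 × Fin mL × Fin mM => ((w i).1, (w i).2.1)) ≤
      entropy (fun w : Fin 2 → Fin m0 × Fin mL × Fin mM =>
        (((w i).1, (w i).2.1), direct (C.enc i (w i)))) :=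
    entropy_mono fun v w h => congrArg Prod.fst h
  have h3 : entropy (fun w : Fin 2 → Fin m0 × Fin mL × Fin mM => direct (C.enc i (w i))) ≤
      N * (M * n) * Real.log (Fintype.card F) := by
    refine le_trans (entropy_mono
      (g := fun w t j (r : {r : Fin (max n k) // max n k ≤ r + n}) =>
        direct (C.enc i (w i)) t j r.1) ?_) ((entropy_le_log_card _).trans
        ((log_card_lower_rows_le F N M (max n k) (fun _ => n)).trans_eq (by simp)))
    intro v w h
    funext t j r
    by_cases hr : max n k ≤ r + n
    · exact congrFun (congrFun (congrFun h t) j) ⟨r, hr⟩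
    · rw [direct_apply, direct_apply, if_neg (by omega), if_neg (by omega)]
  rw [Fintype.card_prod, Fintype.card_fin, Fintype.card_fin, Nat.cast_mul,
    Real.log_mul (by exact_mod_cast hm0.ne') (by exact_mod_cast hmL.ne')] at h1
  rw [entropy_message0L] at h2
  linarith

end Code

/-! ### From codes to rates -/

theorem sum_rowCount (n k : ℕ) {M L : ℕ} (hML : M ≤ 2 * L) (hLM : L ≤ M) :
    (∑ y ∈ range M, (Code.rowCount n k M L y : ℝ)) =
      ((M : ℝ) - L) * ((n - k : ℕ) + max n k) + (2 * (L : ℝ) - M) * max k (n - k : ℕ) := by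
  -- Here a = M - L and b = 2L - M, so the three ranges of `rowCount` have lengths a, b, a.
  obtain ⟨a, rfl⟩ := Nat.exists_eq_add_of_le hLM
  obtain ⟨b, rfl⟩ := Nat.exists_eq_add_of_le (show a ≤ L by omega)
  rw [Finset.sum_range_add, Finset.sum_range_add]
  have e : a + b + a - (a + b) = a := by omega
  have h1 : ∀ y ∈ range a, (Code.rowCount n k (a + b + a) (a + b) y : ℝ) = (n - k : ℕ) := by
    intro y hy
    rw [Code.rowCount, e, if_pos (mem_range.1 hy)]
  have h2 : ∀ y ∈ range b, (Code.rowCount n k (a + b + a) (a + b) (a + y) : ℝ) =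
      (max k (n - k) : ℕ) := by
    intro y hy
    have := mem_range.1 hy
    rw [Code.rowCount, e, if_neg (by omega), if_pos (by omega)]
  have h3 : ∀ y ∈ range a, (Code.rowCount n k (a + b + a) (a + b) (a + b + y) : ℝ) =
      (max n k : ℕ) := by
    intro y hy
    rw [Code.rowCount, e, if_neg (by omega), if_neg (by omega)]
  rw [Finset.sum_congr rfl h1, Finset.sum_congr rfl h2, Finset.sum_congr rfl h3]
  simp only [Finset.sum_const, Finset.card_range, nsmul_eq_mul]
  push_cast
  ring

theorem le_of_forall_large_mul_le {A B D : ℝ} {N₀ : ℕ}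
    (h : ∀ N : ℕ, N₀ ≤ N → A * N ≤ D * N + B) : A ≤ D := by
  by_contra hlt
  push Not at hlt
  obtain ⟨N, hN⟩ := exists_nat_gt (B / (A - D))
  have h1 := h (max N₀ N) (le_max_left _ _)
  have h2 : (N : ℝ) ≤ (max N₀ N : ℕ) := by exact_mod_cast le_max_right _ _
  rw [div_lt_iff₀ (by linarith)] at hN
  nlinarith

theorem le_of_forall_small_mul_le {A E D : ℝ}
    (h : ∀ ε : ℝ, 0 < ε → ε < 1 → (1 - ε) * (A - E * ε) ≤ D) : A ≤ D := by
  have hc : Filter.Tendsto (fun ε : ℝ => (1 - ε) * (A - E * ε)) (nhdsWithin 0 (Set.Ioi 0))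
      (nhds A) := by
    have : Continuous fun ε : ℝ => (1 - ε) * (A - E * ε) := by fun_prop
    simpa using (this.tendsto 0).mono_left nhdsWithin_le_nhds
  refine le_of_tendsto hc ?_
  filter_upwards [Ioo_mem_nhdsGT (zero_lt_one' ℝ)] with ε hε
  exact h ε hε.1 hε.2

/-- A linear bound on the logarithms of the message counts of all codes bounds the rates. -/
theorem Achievable.rate_bound {F : Type*} [Field F] [Fintype F] {n k M L : ℕ} {R0 RL RM : ℝ}
    (h : Achievable F n k M L R0 RL RM) {a b D B : ℝ} (ha : 0 ≤ a) (hb : 0 ≤ b)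
    (hC : ∀ (ε : ℝ) (N m0 mL mM : ℕ) (C : Code F n k M N m0 mL mM),
      Nonempty (Fin m0 × Fin mL × Fin mM) → (∀ i, C.err0 i ≤ ε) →
      (∀ i, ∀ S : Finset (Fin M), #S = L → C.errL i S ≤ ε) →
      (1 - ε) * (a * Real.log mL + b * Real.log m0) ≤ N * D * Real.log (Fintype.card F) + B) :
    a * RL + b * R0 ≤ D := by
  have hq : (1 : ℝ) < Fintype.card F := by exact_mod_cast Fintype.one_lt_card
  have hlq : 0 < Real.log (Fintype.card F) := Real.log_pos hq
  -- The slack ε in both rates costs (a + b) ε in the weighted sum. The additive constant B is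
  -- removed by N → ∞ before ε → 0.
  refine le_of_forall_small_mul_le (E := a + b) fun ε hε hε1 => ?_
  obtain ⟨N₀, hN₀⟩ := h ε hε
  refine le_of_forall_large_mul_le (B := B / Real.log (Fintype.card F)) (N₀ := N₀)
    fun N hN => ?_
  obtain ⟨m0, mL, mM, C, h0, hL, hM, herr⟩ := hN₀ N hN
  have pos : ∀ {m : ℕ} {x : ℝ}, (Fintype.card F : ℝ) ^ x ≤ m → 0 < (m : ℝ) := fun hx =>
    lt_of_lt_of_le (Real.rpow_pos_of_pos (by linarith) _) hx
  have lg : ∀ {m : ℕ} {x : ℝ}, (Fintype.card F : ℝ) ^ x ≤ m →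
      x * Real.log (Fintype.card F) ≤ Real.log m := fun hx => by
    rw [← Real.log_rpow (by linarith)]
    exact Real.log_le_log (Real.rpow_pos_of_pos (by linarith) _) hx
  have hne : Nonempty (Fin m0 × Fin mL × Fin mM) :=
    ⟨(⟨0, by exact_mod_cast pos h0⟩, ⟨0, by exact_mod_cast pos hL⟩, ⟨0, by exact_mod_cast pos hM⟩)⟩
  have key := hC ε N m0 mL mM C hne (fun i => (herr i).2.2) (fun i => (herr i).2.1)
  have l0 := mul_le_mul_of_nonneg_left (lg h0) hb
  have lL := mul_le_mul_of_nonneg_left (lg hL) ha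
  have h1 := mul_le_mul_of_nonneg_left (add_le_add lL l0) (sub_nonneg.2 hε1.le)
  have h2 := h1.trans key
  rw [← mul_le_mul_iff_of_pos_right hlq, add_mul (D * N), div_mul_cancel₀ _ hlq.ne']
  calc _ = _ := by ring
    _ ≤ _ := h2
    _ = _ := by ring

theorem Achievable.outer_bounds {F : Type*} [Field F] [Fintype F] {n k M L : ℕ} (hM : 1 ≤ M)
    (hML : M ≤ 2 * L) (hLM : L ≤ M) {R0 RL RM : ℝ} (h : Achievable F n k M L R0 RL RM) :
    M * RL + ((M : ℝ) - L) * R0 ≤ M * (((M : ℝ) - L) * ((n - k : ℕ) + max n k) +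
      (2 * (L : ℝ) - M) * max k (n - k : ℕ)) ∧ RL + R0 ≤ M * n := by
  have : NeZero M := ⟨by omega⟩
  constructor
  · have hl : (L : ℝ) ≤ M := by exact_mod_cast hLM
    refine h.rate_bound (B := (M + (M - L : ℕ)) * Real.log 2) (by positivity) (by linarith)
      fun ε N m0 mL mM C hne h0 hL => ?_
    have := C.sum_bound hML hLM h0 hL
    rw [sum_rowCount n k hML hLM] at this
    rw [← Nat.cast_sub hLM] at this ⊢
    linarith
  · have := h.rate_bound (a := 1) (b := 1) (D := M * n) (B := Real.log 2) (by norm_num)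
      (by norm_num) fun ε N m0 mL mM C hne h0 hL => by
        have := C.total_bound 0 (h0 0)
        simpa using this
    simpa using this

/-! ### Error-free codes, concatenation and time sharing -/

section ZeroError

variable {F : Type*} [Field F] {n k M L N : ℕ}

/-- Existence of a code of length `N` with messages `W_0` in `A`, `W_L` in `B` and trivial `W_M`
that never makes an error. -/
def ZeroError (F : Type*) [Field F] (n k M L N : ℕ) (A B : Type*) : Prop :=
  ∃ e : Fin 2 → A × B → Signal F n k M N, ∀ i,
    (∀ S : Finset (Fin M), #S = L → ∀ u u' v v' : A × B,
      received S (e i u) (e i.rev v) = received S (e i u') (e i.rev v') → u.2 = u'.2) ∧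
    (∀ u u' : A × B, direct (e i u) = direct (e i u') → u = u')

theorem ZeroError.of_injective {A B A' B' : Type*} (h : ZeroError F n k M L N A B)
    {f : A' → A} {g : B' → B} (hf : f.Injective) (hg : g.Injective) :
    ZeroError F n k M L N A' B' := by
  obtain ⟨e, he⟩ := h
  refine ⟨fun i u => e i (f u.1, g u.2), fun i => ⟨fun S hS u u' v v' h' => ?_, fun u u' h' => ?_⟩⟩
  · exact hg ((he i).1 S hS _ _ _ _ h')
  · have := (he i).2 _ _ h'
    rw [Prod.mk.injEq] at this
    exact Prod.ext (hf this.1) (hg this.2)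

theorem received_append {N₁ N₂ : ℕ} (S : Finset (Fin M)) (x x' : Signal F n k M N₁)
    (y y' : Signal F n k M N₂) :
    received S (Fin.append x y : Signal F n k M (N₁ + N₂)) (Fin.append x' y') =
      Fin.append (received S x x') (received S y y') := by
  funext t
  refine Fin.addCases (fun t => ?_) (fun t => ?_) t <;> funext j <;> simp [received]

theorem append_inj {α : Type*} {N₁ N₂ : ℕ} {x x' : Fin N₁ → α} {y y' : Fin N₂ → α}
    (h : Fin.append x y = Fin.append x' y') : x = x' ∧ y = y' := by
  constructor
  · funext t
    simpa using congrFun h (Fin.castAdd N₂ t)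
  · funext t
    simpa using congrFun h (Fin.natAdd N₁ t)

theorem ZeroError.append {N₁ N₂ : ℕ} {A B A' B' : Type*} (h : ZeroError F n k M L N₁ A B)
    (h' : ZeroError F n k M L N₂ A' B') :
    ZeroError F n k M L (N₁ + N₂) (A × A') (B × B') := by
  obtain ⟨e, he⟩ := h
  obtain ⟨e', he'⟩ := h'
  refine ⟨fun i u => Fin.append (e i (u.1.1, u.2.1)) (e' i (u.1.2, u.2.2)),
    fun i => ⟨fun S hS u u' v v' hh => ?_, fun u u' hh => ?_⟩⟩
  · rw [received_append, received_append] at hh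
    obtain ⟨h1, h2⟩ := append_inj hh
    exact Prod.ext ((he i).1 S hS _ _ _ _ h1) ((he' i).1 S hS _ _ _ _ h2)
  · rw [← received_empty _ (Fin.append (e i (u.1.1, u.2.1)) (e' i (u.1.2, u.2.2))),
      ← received_empty (Fin.append (e i (u'.1.1, u'.2.1)) (e' i (u'.1.2, u'.2.2)))
        (Fin.append (e i (u.1.1, u.2.1)) (e' i (u.1.2, u.2.2))),
      received_append, received_append] at hh
    obtain ⟨h1, h2⟩ := append_inj hh
    rw [received_empty, received_empty] at h1 h2
    have h3 := (he i).2 _ _ h1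
    have h4 := (he' i).2 _ _ h2
    simp only [Prod.mk.injEq] at h3 h4
    exact Prod.ext (Prod.ext h3.1 h4.1) (Prod.ext h3.2 h4.2)

end ZeroError

/-- Existence of an error-free code of length `N` carrying `a` symbols of `W_0` and `b` of `W_L`. -/
def ZeroErrorRate (F : Type*) [Field F] [Fintype F] (n k M L N a b : ℕ) : Prop :=
  ZeroError F n k M L N (Fin (Fintype.card F ^ a)) (Fin (Fintype.card F ^ b))

section ZeroErrorRate

variable {F : Type*} [Field F] [Fintype F] {n k M L N : ℕ}

theorem ZeroError.rate {A B : Type*} [Fintype A] [Fintype B] {a b : ℕ}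
    (h : ZeroError F n k M L N A B) (hA : Fintype.card A = Fintype.card F ^ a)
    (hB : Fintype.card B = Fintype.card F ^ b) : ZeroErrorRate F n k M L N a b :=
  h.of_injective (Fintype.equivFinOfCardEq hA).symm.injective
    (Fintype.equivFinOfCardEq hB).symm.injective

theorem ZeroErrorRate.zero (N : ℕ) : ZeroErrorRate F n k M L N 0 0 := by
  refine ZeroError.rate (A := Unit) (B := Unit) ?_ (by simp) (by simp)
  exact ⟨fun _ _ => 0, fun i => ⟨fun _ _ _ _ _ _ _ => Subsingleton.elim _ _,
    fun _ _ _ => Subsingleton.elim _ _⟩⟩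

theorem ZeroErrorRate.add {N₁ N₂ a b a' b' : ℕ} (h : ZeroErrorRate F n k M L N₁ a b)
    (h' : ZeroErrorRate F n k M L N₂ a' b') :
    ZeroErrorRate F n k M L (N₁ + N₂) (a + a') (b + b') :=
  (ZeroError.append h h').rate (by simp [pow_add]) (by simp [pow_add])

theorem ZeroErrorRate.nsmul {a b : ℕ} (h : ZeroErrorRate F n k M L N a b) (c : ℕ) :
    ZeroErrorRate F n k M L (c * N) (c * a) (c * b) := by
  induction c with
  | zero => simpa using ZeroErrorRate.zero 0
  | succ c ih => simpa only [Nat.succ_mul] using ih.add h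

theorem ZeroErrorRate.exists_code {a b : ℕ} (h : ZeroErrorRate F n k M L N a b) :
    ∃ C : Code F n k M N (Fintype.card F ^ a) (Fintype.card F ^ b) 1, ∀ i : Fin 2,
      C.errM i = 0 ∧ (∀ S : Finset (Fin M), #S = L → C.errL i S = 0) ∧ C.err0 i = 0 := by
  obtain ⟨e, he⟩ := h
  have hq : ∀ c, 0 < Fintype.card F ^ c := fun c => pow_pos Fintype.card_pos c
  have : Nonempty (Fin (Fintype.card F ^ a) × Fin (Fintype.card F ^ b)) :=
    ⟨(⟨0, hq a⟩, ⟨0, hq b⟩)⟩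
  let g : Fin 2 → Finset (Fin M) →
      (Fin (Fintype.card F ^ a) × Fin (Fintype.card F ^ b)) ×
        (Fin (Fintype.card F ^ a) × Fin (Fintype.card F ^ b)) → Signal F n k M N :=
    fun i S p => received S (e i p.1) (e i.rev p.2)
  -- The decoders invert the map from both users' messages to the output; it need not be injective,
  -- but the wanted components are determined.
  refine ⟨⟨fun i w => e i (w.1, w.2.1), fun _ _ => 0,
    fun i S y => ((Function.invFun (g i S) y).1.2, 0),
    fun i y => ((Function.invFun (g i ∅) y).1.1, (Function.invFun (g i ∅) y).1.2, 0)⟩,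
    fun i => ⟨?_, fun S hS => ?_, ?_⟩⟩
  · have : ∀ x y : Fin 1, x = y := fun x y => Subsingleton.elim x y
    simp [Code.errM, uniformProb, this _ 0]
  · unfold Code.errL uniformProb
    convert zero_div _
    rw [Nat.cast_eq_zero, Set.ncard_eq_zero (Set.toFinite _), Set.eq_empty_iff_forall_notMem]
    intro w hw
    rw [Set.mem_ofPred_eq] at hw
    refine hw (Prod.ext ?_ (Subsingleton.elim _ _))
    have h1 := Function.invFun_eq (f := g i S)
      ⟨(((w i).1, (w i).2.1), ((w i.rev).1, (w i.rev).2.1)), rfl⟩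
    exact (he i).1 S hS _ _ _ _ h1
  · unfold Code.err0 uniformProb
    convert zero_div _
    rw [Nat.cast_eq_zero, Set.ncard_eq_zero (Set.toFinite _), Set.eq_empty_iff_forall_notMem]
    intro w hw
    rw [Set.mem_ofPred_eq] at hw
    have h1 := Function.invFun_eq (f := g i ∅)
      ⟨(((w i).1, (w i).2.1), ((w i.rev).1, (w i.rev).2.1)), rfl⟩
    simp only [g, received_empty] at h1
    have h2 := (he i).2 _ _ h1
    rw [Prod.ext_iff] at h2
    refine hw (Prod.ext ?_ (Prod.ext ?_ (Subsingleton.elim _ _)))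
    · simpa only [Code.output, received_empty, g] using h2.1
    · simpa only [Code.output, received_empty, g] using h2.2

/-- Time sharing between two error-free codes. -/
theorem achievable_of_time_sharing {N₁ N₂ a a' b b' : ℕ} (hN₁ : 0 < N₁) (hN₂ : 0 < N₂)
    (h : ZeroErrorRate F n k M L N₁ a b) (h' : ZeroErrorRate F n k M L N₂ a' b')
    {θ R0 RL : ℝ} (hθ : 0 ≤ θ) (hθ1 : θ ≤ 1)
    (h0 : R0 ≤ θ * (a / N₁) + (1 - θ) * (a' / N₂))
    (hL : RL ≤ θ * (b / N₁) + (1 - θ) * (b' / N₂)) : Achievable F n k M L R0 RL 0 := by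
  intro ε hε
  have hq : (1 : ℝ) ≤ Fintype.card F := by exact_mod_cast Fintype.card_pos
  -- Rounding the numbers of repetitions down loses at most a + a' + b + b' symbols, which Nε must
  -- absorb.
  obtain ⟨N₀, hN₀⟩ := exists_nat_gt (((a + a' + b + b' : ℕ) : ℝ) / ε)
  refine ⟨N₀, fun N hN => ?_⟩
  have hNr : ((a + a' + b + b' : ℕ) : ℝ) ≤ N * ε := by
    rw [div_lt_iff₀ hε] at hN₀
    have : (N₀ : ℝ) ≤ N := by exact_mod_cast hN
    nlinarith
  have p1 : (0 : ℝ) < N₁ := by exact_mod_cast hN₁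
  have p2 : (0 : ℝ) < N₂ := by exact_mod_cast hN₂
  set c := ⌊θ * N / N₁⌋₊ with hc
  set c' := ⌊(1 - θ) * N / N₂⌋₊ with hc'
  have c1 : (c : ℝ) ≤ θ * N / N₁ := Nat.floor_le (by positivity)
  have c2 : θ * N / N₁ ≤ c + 1 := (Nat.lt_floor_add_one _).le
  have c1' : (c' : ℝ) ≤ (1 - θ) * N / N₂ :=
    Nat.floor_le (by have := sub_nonneg.2 hθ1; positivity)
  have c2' : (1 - θ) * N / N₂ ≤ c' + 1 := (Nat.lt_floor_add_one _).le
  have hle : c * N₁ + c' * N₂ ≤ N := by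
    rw [le_div_iff₀ p1] at c1
    rw [le_div_iff₀ p2] at c1'
    have : ((c * N₁ + c' * N₂ : ℕ) : ℝ) ≤ N := by push_cast; linarith
    exact_mod_cast this
  obtain ⟨r, hr⟩ := Nat.exists_eq_add_of_le hle
  have hz := ((h.nsmul c).add (h'.nsmul c')).add (ZeroErrorRate.zero r)
  rw [← hr] at hz
  obtain ⟨C, hC⟩ := hz.exists_code
  -- The two hypotheses on x and x' together amount to x + x' ≤ a + a' + b + b'.
  have rate : ∀ {R : ℝ} {x x' : ℕ}, x ≤ a + a' + b + b' - x' → x' ≤ a + a' + b + b' →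
      R ≤ θ * (x / N₁) + (1 - θ) * (x' / N₂) →
      (Fintype.card F : ℝ) ^ ((N : ℝ) * (R - ε)) ≤
        ((Fintype.card F ^ (c * x + c' * x' + 0) : ℕ) : ℝ) := by
    intro R x x' hx hx' hR
    push_cast
    rw [← Real.rpow_natCast]
    refine Real.rpow_le_rpow_of_exponent_le hq ?_
    have e1 : (x : ℝ) + x' ≤ (a + a' + b + b' : ℕ) := by
      exact_mod_cast (by omega : x + x' ≤ a + a' + b + b')
    have e2 := mul_le_mul_of_nonneg_right c2 (Nat.cast_nonneg (α := ℝ) x)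
    have e3 := mul_le_mul_of_nonneg_right c2' (Nat.cast_nonneg (α := ℝ) x')
    have e4 := mul_le_mul_of_nonneg_left hR (Nat.cast_nonneg (α := ℝ) N)
    have e5 : N * (θ * (x / N₁) + (1 - θ) * (x' / N₂)) =
        θ * N / N₁ * x + (1 - θ) * N / N₂ * x' := by ring
    push_cast
    linarith
  refine ⟨_, _, _, C, rate (by omega) (by omega) h0, rate (by omega) (by omega) hL, ?_,
    fun i => ⟨(hC i).1.le.trans hε.le, fun S hS => ((hC i).2.1 S hS).le.trans hε.le,
      (hC i).2.2.le.trans hε.le⟩⟩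
  rw [Nat.cast_one]
  refine Real.rpow_le_one_of_one_le_of_nonpos hq ?_
  have : (0 : ℝ) ≤ N := Nat.cast_nonneg N
  nlinarith

end ZeroErrorRate

/-! ### Reed–Solomon codes across subcarriers -/

/-- Maximum distance separable codes of length `M` over the alphabet of `M`-tuples. -/
theorem exists_mds_code (F : Type*) [Field F] [Fintype F] (M D : ℕ) :
    ∃ enc : (Fin D → (Fin M → F)) → Fin M → (Fin M → F), ∀ T : Finset (Fin M), D ≤ #T →
      ∀ m m', (∀ j ∈ T, enc m j = enc m' j) → m = m' := by
  classical
  rcases Nat.eq_zero_or_pos M with rfl | hM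
  · refine ⟨fun _ j => j.elim0, fun T _ m m' _ => ?_⟩
    funext d j
    exact j.elim0
  obtain ⟨p, _⟩ := CharP.exists F
  obtain ⟨f, hp, hf⟩ := FiniteField.card F p
  have : Fact p.Prime := ⟨hp⟩
  have hfM : (f : ℕ) * M ≠ 0 := by positivity
  -- The extension of size |F|^M always has M distinct evaluation points, even when |F| < M. One of
  -- its symbols is an M-tuple over F, sent over M channel uses.
  set K := GaloisField p (f * M)
  have : Fintype K := Fintype.ofFinite K
  have hK : Fintype.card K = Fintype.card F ^ M := by
    rw [← Nat.card_eq_fintype_card, GaloisField.card p _ hfM, hf, pow_mul]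
  obtain ⟨φ⟩ : Nonempty (K ≃ (Fin M → F)) := Fintype.card_eq.1 (by simp [hK])
  obtain ⟨v⟩ : Nonempty (Fin M ↪ K) := by
    refine Function.Embedding.nonempty_of_card_le ?_
    rw [hK, Fintype.card_fin]
    exact (Nat.lt_pow_self Fintype.one_lt_card).le
  let P : (Fin D → (Fin M → F)) → Polynomial.degreeLT K D :=
    fun m => (Polynomial.degreeLTEquiv K D).symm fun d => φ.symm (m d)
  refine ⟨fun m j => φ ((P m : Polynomial K).eval (v j)), fun T hT m m' h => ?_⟩
  have hdeg : ∀ m, (P m : Polynomial K).degree < #T := fun m =>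
    (Polynomial.mem_degreeLT.1 (P m).2).trans_le (by exact_mod_cast hT)
  have h1 : (P m : Polynomial K) = P m' :=
    Polynomial.eq_of_degrees_lt_of_eval_index_eq T v.injective.injOn (hdeg m) (hdeg m')
      fun j hj => φ.injective (h j hj)
  have h2 := (Polynomial.degreeLTEquiv K D).symm.injective (Subtype.ext h1)
  funext d
  exact φ.symm.injective (congrFun h2 d)

/-! ### Level codes -/

section LevelCodes

variable {F : Type*} [Field F] {n k M L N : ℕ}

/-- The dictionary for all level codes: own level l can collide only with the interferer's level l +
k - n. -/
theorem received_own_row (S : Finset (Fin M)) (x x' : Signal F n k M N) (t : Fin N) (j : Fin M)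
    {l : ℕ} (hl : l < n) :
    received S x x' t j ⟨l + (max n k - n), by omega⟩ = extendZero (x t j) l +
      if j ∈ S then (if n ≤ l + k then extendZero (x' t j) (l + k - n) else 0) else 0 := by
  rw [received_apply]
  have e1 : l + (max n k - n) - (max n k - n) = l := by omega
  have e2 : (max n k - k ≤ l + (max n k - n)) ↔ n ≤ l + k := by omega
  have e3 : l + (max n k - n) - (max n k - k) = l + k - n := by omega
  simp only [e1, e2, e3, Nat.le_add_left, if_true]

/-- Signal of a level code: the symbols `c` on the clean levels, `h` on the levels that may be
hit by interference, silence elsewhere. -/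
def levelSignal (n k : ℕ) (Cl Hs : Finset ℕ) (h : Fin N → Fin M → ℕ → F)
    (c : Fin N → Fin M → Cl → F) : Signal F n k M N :=
  fun t j r => if hr : (r : ℕ) ∈ Cl then c t j ⟨r, hr⟩ else if (r : ℕ) ∈ Hs then h t j r else 0

section

variable {Cl Hs : Finset ℕ} {h : Fin N → Fin M → ℕ → F} {c : Fin N → Fin M → Cl → F}
  {t : Fin N} {j : Fin M}

theorem extendZero_levelSignal_clean {l : ℕ} (hl : l ∈ Cl) (hn : l < n) :
    extendZero (levelSignal n k Cl Hs h c t j) l = c t j ⟨l, hl⟩ := by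
  rw [extendZero, dif_pos (by omega), levelSignal, dif_pos hl]

theorem extendZero_levelSignal_hit {l : ℕ} (hl : l ∈ Hs) (hd : l ∉ Cl) (hn : l < n) :
    extendZero (levelSignal n k Cl Hs h c t j) l = h t j l := by
  rw [extendZero, dif_pos (by omega), levelSignal, dif_neg hd, if_pos hl]

theorem extendZero_levelSignal_silent {l : ℕ} (hl : l ∉ Hs) (hd : l ∉ Cl) :
    extendZero (levelSignal n k Cl Hs h c t j) l = 0 := by
  unfold extendZero levelSignal
  split_ifs <;> simp_all

end

/-- Codes in which both users send uncoded symbols of `W_L` on levels that are never interfered, and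
arbitrary symbols on some of the other levels. -/
theorem ZeroError.of_levels {A B : Type*} {Cl Hs : Finset ℕ}
    (hCl : ∀ l ∈ Cl, l < n) (hHs : ∀ l ∈ Hs, l < n) (hd : ∀ l ∈ Hs, l ∉ Cl)
    (hclean : ∀ l ∈ Cl, n ≤ l + k → l + k - n ∉ Cl ∧ l + k - n ∉ Hs)
    (h : A → B → Fin N → Fin M → ℕ → F)
    (hfull : ∀ a a' b b', (∀ t j, ∀ l ∈ Hs, h a b t j l = h a' b' t j l) → a = a' ∧ b = b')
    (hpart : ∀ T : Finset (Fin M), #T = M - L → ∀ a a' b b',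
      (∀ t, ∀ j ∈ T, ∀ l ∈ Hs, h a b t j l = h a' b' t j l) → b = b') :
    ZeroError F n k M L N A (B × (Fin N → Fin M → Cl → F)) := by
  have clean : ∀ (S : Finset (Fin M)) (u u' v v' : A × (B × (Fin N → Fin M → Cl → F))),
      received S (levelSignal n k Cl Hs (h u.1 u.2.1) u.2.2)
        (levelSignal n k Cl Hs (h v.1 v.2.1) v.2.2) =
      received S (levelSignal n k Cl Hs (h u'.1 u'.2.1) u'.2.2)
        (levelSignal n k Cl Hs (h v'.1 v'.2.1) v'.2.2) → u.2.2 = u'.2.2 := by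
    intro S u u' v v' hh
    funext t j ⟨l, hl⟩
    have h1 := congrFun (congrFun (congrFun hh t) j)
      ⟨l + (max n k - n), by have := hCl l hl; omega⟩
    rw [received_own_row _ _ _ _ _ (hCl l hl), received_own_row _ _ _ _ _ (hCl l hl),
      extendZero_levelSignal_clean hl (hCl l hl), extendZero_levelSignal_clean hl (hCl l hl)] at h1
    by_cases hnk : n ≤ l + k
    · obtain ⟨h2, h3⟩ := hclean l hl hnk
      simpa [extendZero_levelSignal_silent h3 h2] using h1
    · simpa [hnk] using h1
  -- On uninterfered subcarriers the hit levels arrive intact, whatever the other user sends.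
  have hit : ∀ (S : Finset (Fin M)) (u u' v v' : A × (B × (Fin N → Fin M → Cl → F))),
      received S (levelSignal n k Cl Hs (h u.1 u.2.1) u.2.2)
        (levelSignal n k Cl Hs (h v.1 v.2.1) v.2.2) =
      received S (levelSignal n k Cl Hs (h u'.1 u'.2.1) u'.2.2)
        (levelSignal n k Cl Hs (h v'.1 v'.2.1) v'.2.2) →
      ∀ t, ∀ j ∈ Sᶜ, ∀ l ∈ Hs, h u.1 u.2.1 t j l = h u'.1 u'.2.1 t j l := by
    intro S u u' v v' hh t j hj l hl
    have h1 := congrFun (congrFun (congrFun hh t) j)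
      ⟨l + (max n k - n), by have := hHs l hl; omega⟩
    rw [received_own_row _ _ _ _ _ (hHs l hl), received_own_row _ _ _ _ _ (hHs l hl),
      extendZero_levelSignal_hit hl (hd l hl) (hHs l hl),
      extendZero_levelSignal_hit hl (hd l hl) (hHs l hl)] at h1
    simpa [mem_compl.1 hj] using h1
  refine ⟨fun _ u => levelSignal n k Cl Hs (h u.1 u.2.1) u.2.2,
    fun i => ⟨fun S hS u u' v v' hh => ?_, fun u u' hh => ?_⟩⟩
  · refine Prod.ext (hpart Sᶜ ?_ u.1 u'.1 u.2.1 u'.2.1 (hit S u u' v v' hh))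
      (clean S u u' v v' hh)
    rw [card_compl, Fintype.card_fin, hS]
  · rw [← received_empty _ (levelSignal n k Cl Hs (h u.1 u.2.1) u.2.2),
      ← received_empty (levelSignal n k Cl Hs (h u'.1 u'.2.1) u'.2.2)
        (levelSignal n k Cl Hs (h u.1 u.2.1) u.2.2)] at hh
    have h1 := hfull u.1 u'.1 u.2.1 u'.2.1 fun t j => hit ∅ u u' u u hh t j (by simp)
    exact Prod.ext h1.1 (Prod.ext h1.2 (clean ∅ u u' u u hh))

end LevelCodes

section LevelRates

variable {F : Type*} [Field F] [Fintype F] {n k M L : ℕ}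

/-- The levels that may be hit carry uncoded symbols of `W_0`. -/
theorem zeroErrorRate_opportunistic {Cl Hs : Finset ℕ}
    (hCl : ∀ l ∈ Cl, l < n) (hHs : ∀ l ∈ Hs, l < n) (hd : ∀ l ∈ Hs, l ∉ Cl)
    (hclean : ∀ l ∈ Cl, n ≤ l + k → l + k - n ∉ Cl ∧ l + k - n ∉ Hs) :
    ZeroErrorRate F n k M L 1 (M * #Hs) (M * #Cl) := by
  classical
  refine ZeroError.rate (ZeroError.of_levels (A := Fin 1 → Fin M → Hs → F) (B := Unit) (N := 1)
    hCl hHs hd hclean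
    (fun a _ t j l => if hl : l ∈ Hs then a t j ⟨l, hl⟩ else 0)
    (fun a a' b b' h => ⟨?_, rfl⟩) (fun _ _ _ _ _ _ _ => rfl)) ?_ ?_
  · funext t j ⟨l, hl⟩
    simpa [hl] using h t j l hl
  · simp [← pow_mul, mul_comm]
  · simp [← pow_mul, mul_comm]

/-- The levels that may be hit carry symbols of `W_L`, protected against erasures of `L`
subcarriers. -/
theorem zeroErrorRate_erasure {Cl Hs : Finset ℕ}
    (hCl : ∀ l ∈ Cl, l < n) (hHs : ∀ l ∈ Hs, l < n) (hd : ∀ l ∈ Hs, l ∉ Cl)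
    (hclean : ∀ l ∈ Cl, n ≤ l + k → l + k - n ∉ Cl ∧ l + k - n ∉ Hs) :
    ZeroErrorRate F n k M L M 0 (M * ((M - L) * #Hs + M * #Cl)) := by
  classical
  obtain ⟨enc, henc⟩ := exists_mds_code F M (M - L)
  have key : ∀ T : Finset (Fin M), M - L ≤ #T → ∀ b b' : Hs → Fin (M - L) → Fin M → F,
      (∀ t : Fin M, ∀ j ∈ T, ∀ l ∈ Hs,
        (if hl : l ∈ Hs then enc (b ⟨l, hl⟩) j t else 0) =
        (if hl : l ∈ Hs then enc (b' ⟨l, hl⟩) j t else 0)) → b = b' := by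
    intro T hT b b' h
    funext ⟨l, hl⟩
    refine henc T hT _ _ fun j hj => ?_
    funext t
    simpa [hl] using h t j hj l hl
  refine ZeroError.rate (ZeroError.of_levels (A := Unit) (B := Hs → Fin (M - L) → Fin M → F)
    (N := M) hCl hHs hd hclean
    (fun _ b t j l => if hl : l ∈ Hs then enc (b ⟨l, hl⟩) j t else 0)
    (fun a a' b b' h => ⟨rfl, key univ (by simp) b b' fun t j _ l hl => h t j l hl⟩)
    (fun T hT _ _ b b' h => key T hT.ge b b' h)) (by simp) ?_
  simp only [Fintype.card_prod, Fintype.card_fun, Fintype.card_fin, Fintype.card_coe]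
  rw [← pow_mul, ← pow_mul, ← pow_mul, ← pow_mul, ← pow_add]
  congr 1
  ring

end LevelRates

/-! ### Pair codes with alternating roles -/

section PairCodes

variable {F : Type*} [Field F] {n k M L : ℕ}

/-- Received symbol in row `r` on an interfered subcarrier. -/
def rowSum (n k : ℕ) (x x' : ℕ → F) (r : ℕ) : F :=
  (if max n k - n ≤ r then x (r - (max n k - n)) else 0) +
    (if max n k - k ≤ r then x' (r - (max n k - k)) else 0)

/-- Codes that treat all subcarriers separately, and in which the two users exchange their roles
after each channel use. -/
theorem ZeroError.of_pair {A B : Type*} (e₁ : A → ℕ → F) (e₂ : B → ℕ → F)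
    (h₁ : ∀ a a' b b', (∀ r < max n k, rowSum n k (e₁ a) (e₂ b) r =
      rowSum n k (e₁ a') (e₂ b') r) → a = a')
    (h₂ : ∀ a a' b b', (∀ r < max n k, rowSum n k (e₂ b) (e₁ a) r =
      rowSum n k (e₂ b') (e₁ a') r) → b = b') :
    ZeroError F n k M L 2 Unit ((Fin M → A) × (Fin M → B)) := by
  set e : Fin 2 → Unit × ((Fin M → A) × (Fin M → B)) → Signal F n k M 2 :=
    fun i u t j r => if i = t then e₁ (u.2.1 j) r else e₂ (u.2.2 j) r with he
  have hrev : ∀ i : Fin 2, i.rev ≠ i := by decide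
  have ext_eq : ∀ (x : ℕ → F) (l : ℕ), l < max n k →
      extendZero (fun r : Fin (max n k) => x r) l = x l := by
    intro x l hl
    simp [extendZero, hl]
  have row : ∀ (x x' : ℕ → F) (r : ℕ), r < max n k →
      (if max n k - n ≤ r then extendZero (fun r : Fin (max n k) => x r) (r - (max n k - n))
        else 0) +
      (if max n k - k ≤ r then extendZero (fun r : Fin (max n k) => x' r) (r - (max n k - k))
        else 0) = rowSum n k x x' r := by
    intro x x' r hr
    rw [ext_eq _ _ (by omega), ext_eq _ _ (by omega), rowSum]
  have main : ∀ i S u u' v v', received S (e i u) (e i.rev v) = received S (e i u') (e i.rev v') →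
      u = u' := by
    intro i S u u' v v' h
    refine Prod.ext rfl (Prod.ext ?_ ?_)
    · funext j
      by_cases hj : j ∈ S
      · refine h₁ _ _ (v.2.2 j) (v'.2.2 j) fun r hr => ?_
        have h1 := congrFun (congrFun (congrFun h i) j) ⟨r, hr⟩
        simp only [received_apply, he, hj, if_true, hrev i, if_false] at h1
        rwa [row _ _ _ hr, row _ _ _ hr] at h1
      -- An uninterfered subcarrier is treated as interfered by a dummy signal, added equally to
      -- both sides.
      · refine h₁ _ _ (u.2.2 j) (u.2.2 j) fun r hr => ?_
        have h1 := congrFun (congrFun (congrFun h i) j) ⟨r, hr⟩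
        simp only [received_apply, he, hj, if_true, if_false, add_zero] at h1
        rw [← row _ _ _ hr, ← row _ _ _ hr, h1]
    · funext j
      by_cases hj : j ∈ S
      · refine h₂ (v.2.1 j) (v'.2.1 j) _ _ fun r hr => ?_
        have h1 := congrFun (congrFun (congrFun h i.rev) j) ⟨r, hr⟩
        simp only [received_apply, he, hj, if_true, (hrev i).symm, if_false] at h1
        rwa [row _ _ _ hr, row _ _ _ hr] at h1
      · refine h₂ (u.2.1 j) (u.2.1 j) _ _ fun r hr => ?_
        have h1 := congrFun (congrFun (congrFun h i.rev) j) ⟨r, hr⟩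
        simp only [received_apply, he, hj, (hrev i).symm, if_false, add_zero] at h1
        rw [← row _ _ _ hr, ← row _ _ _ hr, h1]
  refine ⟨e, fun i => ⟨fun S _ u u' v v' h => ?_, fun u u' h => ?_⟩⟩
  · rw [main i S u u' v v' h]
  · refine main i ∅ u u' u u ?_
    rw [received_empty, received_empty, h]

/-- Extension by zero of a family indexed by a finite set of levels. -/
def extendLevels (P : Finset ℕ) (a : P → F) (l : ℕ) : F := if h : l ∈ P then a ⟨l, h⟩ else 0

theorem extendLevels_of_notMem {P : Finset ℕ} {a : P → F} {l : ℕ} (h : l ∉ P) :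
    extendLevels P a l = 0 := dif_neg h

theorem extendLevels_inj {P : Finset ℕ} {a a' : P → F}
    (h : ∀ l ∈ P, extendLevels P a l = extendLevels P a' l) : a = a' := by
  funext ⟨l, hl⟩
  simpa [extendLevels, hl] using h l hl

theorem ZeroErrorRate.of_pair [Fintype F] {P Q : Finset ℕ} (e₁ : (P → F) → ℕ → F)
    (h₁ : ∀ a a' b b', (∀ r < max n k, rowSum n k (e₁ a) (extendLevels Q b) r =
      rowSum n k (e₁ a') (extendLevels Q b') r) → a = a')
    (h₂ : ∀ a a' b b', (∀ r < max n k, rowSum n k (extendLevels Q b) (e₁ a) r =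
      rowSum n k (extendLevels Q b') (e₁ a') r) → b = b') :
    ZeroErrorRate F n k M L 2 0 (M * (#P + #Q)) := by
  classical
  refine ZeroError.rate (ZeroError.of_pair e₁ (extendLevels Q) h₁ h₂) (by simp) ?_
  simp only [Fintype.card_prod, Fintype.card_fun, Fintype.card_fin, Fintype.card_coe]
  rw [← pow_mul, ← pow_mul, ← pow_add]
  congr 1
  ring

/-- Write n = k + d. The first role fills all levels but [d, 2d), the second fills [0, d) and [k, k
+ d); the first role's information levels are hit only by silent ones. The second role's levels in
[k, k + d) are hit by [k - d, k) of the first. Its part [k - s, k) is repeated on [d, d + s), which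
arrives at the other receiver in rows [2d, 2d + s), unused by the second role, and can be cancelled.
If s < d, the rest of [k - d, k) lies in the silent gap. -/
theorem zeroErrorRate_moderate [Fintype F] (hk : k ≤ n) (hk3 : 2 * n ≤ 3 * k) :
    ZeroErrorRate F n k M L 2 0 (M * (2 * n - k)) := by
  classical
  obtain ⟨d, rfl⟩ : ∃ d, n = k + d := ⟨n - k, by omega⟩
  set s := min d (k - 2 * d) with hs
  have hmax : max (k + d) k = k + d := by omega
  have hk2 : 2 * d ≤ k := by omega
  have e0 : k + d - k = d := by omega
  have hrow : ∀ (x x' : ℕ → F) r, rowSum (k + d) k x x' r = x r + if d ≤ r then x' (r - d) else 0 := by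
    intro x x' r
    simp [rowSum, e0]
  set P : Finset ℕ := range (k + d) \ Ico d (2 * d) with hP
  set Q : Finset ℕ := range d ∪ Ico k (k + d) with hQ
  have memP : ∀ l, l ∈ P ↔ l < k + d ∧ ¬ (d ≤ l ∧ l < 2 * d) := by simp [hP]
  have memQ : ∀ l, l ∈ Q ↔ l < d ∨ (k ≤ l ∧ l < k + d) := by simp [hQ]
  have cP : #P = k := by
    rw [hP, card_sdiff_of_subset (by intro l; simp; omega), card_range, Nat.card_Ico]
    omega
  have cQ : #Q = 2 * d := by
    rw [hQ, card_union_of_disjoint, card_range, Nat.card_Ico]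
    · omega
    · rw [disjoint_left]
      intro l
      simp
      omega
  set e₁ : (P → F) → ℕ → F := fun a l =>
    if d ≤ l ∧ l < d + s then extendLevels P a (l - d + (k - s)) else extendLevels P a l with he₁
  have e₁_P : ∀ a l, l ∈ P → e₁ a l = extendLevels P a l := by
    intro a l hl
    rw [memP] at hl
    exact if_neg (by omega)
  have hres := ZeroErrorRate.of_pair (F := F) (n := k + d) (k := k) (M := M) (L := L) (P := P) (Q := Q)
    e₁ (fun a a' b b' h => extendLevels_inj fun l hl => ?_)
    (fun a a' b b' h => extendLevels_inj fun l hl => ?_)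
  · rw [cP, cQ] at hres
    convert hres using 2
    omega
  · have hl' := (memP l).1 hl
    have h1 := h l (by omega)
    rw [hrow, hrow, e₁_P _ _ hl, e₁_P _ _ hl] at h1
    by_cases hdl : d ≤ l
    · have hQ' : l - d ∉ Q := by rw [memQ]; omega
      simpa [extendLevels_of_notMem hQ'] using h1
    · simpa [hdl] using h1
  · have hl' := (memQ l).1 hl
    have h1 := h l (by omega)
    rw [hrow, hrow] at h1
    by_cases hdl : d ≤ l
    · rw [if_pos hdl, if_pos hdl] at h1
      suffices e₁ a (l - d) = e₁ a' (l - d) by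
        rw [this] at h1
        exact add_right_cancel h1
      by_cases hr : k - s ≤ l - d
      · have hP' : l - d ∈ P := by rw [memP]; omega
        have h2 := h (l - d - (k - s) + 2 * d) (by omega)
        have hQ' : l - d - (k - s) + 2 * d ∉ Q := by rw [memQ]; omega
        rw [hrow, hrow, extendLevels_of_notMem hQ', extendLevels_of_notMem hQ',
          if_pos (by omega), if_pos (by omega), zero_add, zero_add] at h2
        simp only [he₁] at h2
        rw [if_pos (by omega), if_pos (by omega)] at h2
        rw [e₁_P _ _ hP', e₁_P _ _ hP']
        convert h2 using 2 <;> omega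
      · have hP' : l - d ∉ P := by rw [memP]; omega
        simp only [he₁]
        rw [if_neg (by omega), if_neg (by omega), extendLevels_of_notMem hP',
          extendLevels_of_notMem hP']
    · simpa [hdl] using h1

/-- Write k = n + d. The first role uses levels below n, the second those below d, so the first is
received cleanly. The second is hit by levels [d, 2d) of the first. The first role repeats levels
[d, d + s) on its s lowest levels, which are below its own receiver's noise floor and reach the
other receiver in rows where that receiver's own signal is silent. Any other colliding level is
silent. -/
theorem zeroErrorRate_strong [Fintype F] (hk : n ≤ k) (hk2 : k ≤ 2 * n) :
    ZeroErrorRate F n k M L 2 0 (M * k) := by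
  classical
  obtain ⟨d, rfl⟩ : ∃ d, k = n + d := ⟨k - n, by omega⟩
  set s := min d (n - d) with hs
  have hmax : max n (n + d) = n + d := by omega
  have e0 : n + d - n = d := by omega
  have hrow : ∀ (x x' : ℕ → F) r,
      rowSum n (n + d) x x' r = (if d ≤ r then x (r - d) else 0) + x' r := by
    intro x x' r
    simp [rowSum, e0]
  set e₁ : (range n → F) → ℕ → F := fun a l =>
    if n + d - s ≤ l ∧ l < n + d then extendLevels (range n) a (l - (n + d - s) + d)
    else extendLevels (range n) a l with he₁
  have e₁_P : ∀ a l, l < n + d - s → e₁ a l = extendLevels (range n) a l := by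
    intro a l hl
    exact if_neg (by omega)
  have hres := ZeroErrorRate.of_pair (F := F) (n := n) (k := n + d) (M := M) (L := L)
    (P := range n) (Q := range d)
    e₁ (fun a a' b b' h => extendLevels_inj fun l hl => ?_)
    (fun a a' b b' h => extendLevels_inj fun l hl => ?_)
  · rwa [card_range, card_range] at hres
  · have hl' := mem_range.1 hl
    have h1 := h (l + d) (by omega)
    have hQ' : l + d ∉ range d := by simp
    rw [hrow, hrow, extendLevels_of_notMem hQ', extendLevels_of_notMem hQ',
      if_pos (by omega), if_pos (by omega), add_zero, add_zero, Nat.add_sub_cancel,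
      e₁_P _ _ (by omega), e₁_P _ _ (by omega)] at h1
    exact h1
  · have hl' := mem_range.1 hl
    have h1 := h (l + d) (by omega)
    rw [hrow, hrow, if_pos (by omega), if_pos (by omega), Nat.add_sub_cancel] at h1
    suffices e₁ a (l + d) = e₁ a' (l + d) by
      rw [this] at h1
      exact add_right_cancel h1
    rw [e₁_P _ _ (by omega), e₁_P _ _ (by omega)]
    by_cases hr : l + d < n
    · have h2 := h (l + (n + d - s)) (by omega)
      have hQ' : l + (n + d - s) - d ∉ range d := by simp; omega
      rw [hrow, hrow, if_pos (by omega), if_pos (by omega), extendLevels_of_notMem hQ',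
        extendLevels_of_notMem hQ', zero_add, zero_add] at h2
      simp only [he₁] at h2
      rw [if_pos (by omega), if_pos (by omega), Nat.add_sub_cancel] at h2
      exact h2
    · have hP' : l + d ∉ range n := by simp; omega
      rw [extendLevels_of_notMem hP', extendLevels_of_notMem hP']

end PairCodes

/-! ### Corner points and the inner bound -/

/-- The pair of rates `(x, y)` of `(W_0, W_L)` is attained by an error-free code. -/
def IsCorner (F : Type*) [Field F] [Fintype F] (n k M L : ℕ) (x y : ℝ) : Prop :=
  ∃ N a b : ℕ, 0 < N ∧ ZeroErrorRate F n k M L N a b ∧ x = a / N ∧ y = b / N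

section Corners

variable {F : Type*} [Field F] [Fintype F] {n k M L : ℕ}

/-- The point lies below the chord joining the two corners. The chord condition is cleared of
denominators so that it follows from a multiple of one rate inequality; a vertical chord is handled
by `hdeg`. -/
theorem IsCorner.achievable {x₁ y₁ x₂ y₂ R0 RL : ℝ} (h₁ : IsCorner F n k M L x₁ y₁)
    (h₂ : IsCorner F n k M L x₂ y₂) (hx₁ : x₁ ≤ R0) (hx₂ : R0 ≤ x₂)
    (hline : RL * (x₂ - x₁) ≤ (x₂ - R0) * y₁ + (R0 - x₁) * y₂) (hdeg : x₁ = x₂ → RL ≤ y₁) :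
    Achievable F n k M L R0 RL 0 := by
  obtain ⟨N₁, a, b, hN₁, hz, rfl, rfl⟩ := h₁
  obtain ⟨N₂, a', b', hN₂, hz', rfl, rfl⟩ := h₂
  set x₁ : ℝ := a / N₁
  set y₁ : ℝ := b / N₁
  set x₂ : ℝ := a' / N₂
  set y₂ : ℝ := b' / N₂
  rcases (hx₁.trans hx₂).eq_or_lt with he | hlt
  · refine achievable_of_time_sharing hN₁ hN₂ hz hz' zero_le_one le_rfl ?_ ?_
    · rw [sub_self, zero_mul, one_mul, add_zero]
      exact hx₂.trans he.ge
    · rw [sub_self, zero_mul, one_mul, add_zero]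
      exact hdeg he
  · have hp : 0 < x₂ - x₁ := sub_pos.2 hlt
    have e : 1 - (x₂ - R0) / (x₂ - x₁) = (R0 - x₁) / (x₂ - x₁) := by
      field_simp
      ring
    refine achievable_of_time_sharing (θ := (x₂ - R0) / (x₂ - x₁)) hN₁ hN₂ hz hz'
      (div_nonneg (by linarith) hp.le) ((div_le_one hp).2 (by linarith)) ?_ ?_
    · rw [e]
      change R0 ≤ (x₂ - R0) / (x₂ - x₁) * x₁ + (R0 - x₁) / (x₂ - x₁) * x₂
      refine le_of_eq ?_
      field_simp
      ring
    · rw [e]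
      change RL ≤ (x₂ - R0) / (x₂ - x₁) * y₁ + (R0 - x₁) / (x₂ - x₁) * y₂
      rw [← mul_le_mul_iff_of_pos_right hp]
      refine hline.trans (le_of_eq ?_)
      field_simp

theorem isCorner_opportunistic {Cl Hs : Finset ℕ} {x y : ℝ}
    (hCl : ∀ l ∈ Cl, l < n) (hHs : ∀ l ∈ Hs, l < n) (hd : ∀ l ∈ Hs, l ∉ Cl)
    (hclean : ∀ l ∈ Cl, n ≤ l + k → l + k - n ∉ Cl ∧ l + k - n ∉ Hs)
    (hx : x = M * (#Hs : ℝ)) (hy : y = M * (#Cl : ℝ)) : IsCorner F n k M L x y :=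
  ⟨1, _, _, one_pos, zeroErrorRate_opportunistic hCl hHs hd hclean, by simp [hx], by simp [hy]⟩

theorem isCorner_erasure (hM : 1 ≤ M) (hLM : L ≤ M) {Cl Hs : Finset ℕ} {y : ℝ}
    (hCl : ∀ l ∈ Cl, l < n) (hHs : ∀ l ∈ Hs, l < n) (hd : ∀ l ∈ Hs, l ∉ Cl)
    (hclean : ∀ l ∈ Cl, n ≤ l + k → l + k - n ∉ Cl ∧ l + k - n ∉ Hs)
    (hy : y = ((M : ℝ) - L) * #Hs + M * #Cl) : IsCorner F n k M L 0 y := by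
  have : (M : ℝ) ≠ 0 := by positivity
  refine ⟨M, _, _, hM, zeroErrorRate_erasure hCl hHs hd hclean, by simp, ?_⟩
  rw [hy]
  push_cast [Nat.cast_sub hLM]
  field_simp

theorem isCorner_full : IsCorner F n k M L (M * n) 0 :=
  isCorner_opportunistic (Cl := ∅) (Hs := range n) (by simp) (by simp) (by simp) (by simp)
    (by simp) (by simp)

theorem isCorner_weak_opportunistic (hk : k ≤ n) :
    IsCorner F n k M L (M * k) (M * ((n : ℝ) - k)) := by
  refine isCorner_opportunistic (Cl := range (n - k)) (Hs := Ico (n - k) n) ?_ ?_ ?_ ?_ ?_ ?_ <;>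
    simp [Nat.cast_sub hk] <;> intros <;> omega

theorem isCorner_weak_erasure (hM : 1 ≤ M) (hLM : L ≤ M) (hk : k ≤ n) :
    IsCorner F n k M L 0 (((M : ℝ) - L) * k + M * ((n : ℝ) - k)) := by
  refine isCorner_erasure hM hLM (Cl := range (n - k)) (Hs := Ico (n - k) n) ?_ ?_ ?_ ?_ ?_ <;>
    simp [Nat.cast_sub hk] <;> intros <;> omega

/-- Silence on [n - k, k) frees exactly the levels [2n - 2k, n) that it would hit; levels below n -
k are never hit. -/
theorem silent_middle_levels (h1 : n ≤ 2 * k) (h2 : 3 * k ≤ 2 * n) :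
    (∀ l ∈ range (n - k) ∪ Ico (2 * n - 2 * k) n, l < n) ∧ (∀ l ∈ Ico k (2 * n - 2 * k), l < n) ∧
    (∀ l ∈ Ico k (2 * n - 2 * k), l ∉ range (n - k) ∪ Ico (2 * n - 2 * k) n) ∧
    (∀ l ∈ range (n - k) ∪ Ico (2 * n - 2 * k) n, n ≤ l + k →
      l + k - n ∉ range (n - k) ∪ Ico (2 * n - 2 * k) n ∧ l + k - n ∉ Ico k (2 * n - 2 * k)) ∧
    #(range (n - k) ∪ Ico (2 * n - 2 * k) n) = k ∧
    #(Ico k (2 * n - 2 * k)) = 2 * n - 3 * k := by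
  refine ⟨?_, ?_, ?_, ?_, ?_, ?_⟩
  · simp only [mem_union, mem_range, mem_Ico]; omega
  · simp only [mem_Ico]; omega
  · simp only [mem_union, mem_range, mem_Ico]; omega
  · simp only [mem_union, mem_range, mem_Ico]; omega
  · rw [card_union_of_disjoint, card_range, Nat.card_Ico]
    · omega
    · rw [disjoint_left]
      simp only [mem_range, mem_Ico]
      omega
  · rw [Nat.card_Ico]; omega

theorem isCorner_middle_opportunistic (h1 : n ≤ 2 * k) (h2 : 3 * k ≤ 2 * n) :
    IsCorner F n k M L (M * (2 * (n : ℝ) - 3 * k)) (M * k) := by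
  obtain ⟨p1, p2, p3, p4, p5, p6⟩ := silent_middle_levels h1 h2
  refine isCorner_opportunistic p1 p2 p3 p4 ?_ ?_
  · rw [p6, Nat.cast_sub h2]; push_cast; ring
  · rw [p5]

theorem isCorner_middle_erasure (hM : 1 ≤ M) (hLM : L ≤ M) (h1 : n ≤ 2 * k)
    (h2 : 3 * k ≤ 2 * n) :
    IsCorner F n k M L 0 (((M : ℝ) - L) * (2 * (n : ℝ) - 3 * k) + M * k) := by
  obtain ⟨p1, p2, p3, p4, p5, p6⟩ := silent_middle_levels h1 h2
  refine isCorner_erasure hM hLM p1 p2 p3 p4 ?_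
  rw [p5, p6, Nat.cast_sub h2]; push_cast; ring

theorem isCorner_moderate (hk : k ≤ n) (hk3 : 2 * n ≤ 3 * k) :
    IsCorner F n k M L 0 (M * (2 * (n : ℝ) - k) / 2) := by
  refine ⟨2, _, _, two_pos, zeroErrorRate_moderate hk hk3, by simp, ?_⟩
  push_cast [Nat.cast_sub (show k ≤ 2 * n by omega)]
  ring

theorem isCorner_strong (hk : n ≤ k) (hk2 : k ≤ 2 * n) :
    IsCorner F n k M L 0 (M * (k : ℝ) / 2) :=
  ⟨2, _, _, two_pos, zeroErrorRate_strong hk hk2, by simp, by push_cast; ring⟩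

/-- Levels from 2n - k on could be hit only by levels of index at least n, which never reach their
own receiver and are left silent. -/
theorem isCorner_strong_opportunistic (hk : n ≤ k) (hk2 : k ≤ 2 * n) :
    IsCorner F n k M L (M * (2 * (n : ℝ) - k)) (M * ((k : ℝ) - n)) := by
  refine isCorner_opportunistic (Cl := Ico (2 * n - k) n) (Hs := range (2 * n - k))
    ?_ ?_ ?_ ?_ ?_ ?_
  · simp only [mem_Ico]; omega
  · simp only [mem_range]; omega
  · simp only [mem_range, mem_Ico]; omega
  · simp only [mem_range, mem_Ico]; omega
  · rw [card_range, Nat.cast_sub hk2]; push_cast; ring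
  · rw [Nat.card_Ico, show n - (2 * n - k) = k - n by omega, Nat.cast_sub hk]

/-- In each regime of k/n the corners are ordered by R0, and every segment lies on one of the
bounding lines. For k ≤ n/2 these are (a), (b); for n/2 ≤ k ≤ 2n/3 they are (a), (c), (b); for
larger k they are (c), (b). Each chord condition is the relevant inequality multiplied by a
nonnegative factor proportional to the segment's length. -/
theorem achievable_of_inner_bounds (hM : 1 ≤ M) (hk : k ≤ 2 * n) (hLM : L ≤ M) {R0 RL : ℝ}
    (hR0 : 0 ≤ R0) (hRL : 0 ≤ RL)
    (ha : M * RL + ((M : ℝ) - L) * R0 ≤ M * (((M : ℝ) - L) * (max ((n : ℝ) - k) 0 + max (n : ℝ) k) +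
      (2 * (L : ℝ) - M) * max (k : ℝ) (n - k)))
    (hb : RL + R0 ≤ M * n)
    (hc : 2 * RL + R0 ≤ M * (max (n : ℝ) k + max ((n : ℝ) - k) 0)) :
    Achievable F n k M L R0 RL 0 := by
  have hM0 : (0 : ℝ) < M := by exact_mod_cast hM
  have hk0 : (0 : ℝ) ≤ k := Nat.cast_nonneg k
  have hkr : (k : ℝ) ≤ 2 * n := by exact_mod_cast hk
  rcases le_total k n with hkn | hkn
  · have hknr : (k : ℝ) ≤ n := by exact_mod_cast hkn
    rw [max_eq_left (sub_nonneg.2 hknr), max_eq_left hknr] at ha hc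
    by_cases hlast : (M : ℝ) * k ≤ R0
    · refine (isCorner_weak_opportunistic hkn).achievable isCorner_full hlast (by linarith) ?_ ?_
      · have := mul_le_mul_of_nonneg_left hb (mul_nonneg hM0.le (sub_nonneg.2 hknr))
        linarith
      · intro he
        linarith
    push Not at hlast
    rcases le_total (2 * k) n with h2 | h2
    · have h2r : 2 * (k : ℝ) ≤ n := by exact_mod_cast h2
      rw [max_eq_right (by linarith)] at ha
      refine (isCorner_weak_erasure hM hLM hkn).achievable (isCorner_weak_opportunistic hkn)
        hR0 hlast.le ?_ ?_
      · have := mul_le_mul_of_nonneg_left ha hk0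
        linarith
      · intro he
        linarith
    have h2r : (n : ℝ) ≤ 2 * k := by exact_mod_cast h2
    rw [max_eq_left (by linarith)] at ha
    rcases le_total (3 * k) (2 * n) with h3 | h3
    · have h3r : 3 * (k : ℝ) ≤ 2 * n := by exact_mod_cast h3
      by_cases hmid : (M : ℝ) * (2 * n - 3 * k) ≤ R0
      · refine (isCorner_middle_opportunistic h2 h3).achievable (isCorner_weak_opportunistic hkn)
          hmid hlast.le ?_ ?_
        · have := mul_le_mul_of_nonneg_left hc (mul_nonneg hM0.le (sub_nonneg.2 h2r))
          linarith
        · intro he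
          linarith
      · push Not at hmid
        refine (isCorner_middle_erasure hM hLM h2 h3).achievable
          (isCorner_middle_opportunistic h2 h3) hR0 hmid.le ?_ ?_
        · have := mul_le_mul_of_nonneg_left ha (sub_nonneg.2 h3r)
          linarith
        · intro he
          linarith
    · refine (isCorner_moderate hkn h3).achievable (isCorner_weak_opportunistic hkn)
        hR0 hlast.le ?_ ?_
      · have := mul_le_mul_of_nonneg_left hc (mul_nonneg hM0.le hk0)
        linarith
      · intro he
        linarith
  · have hknr : (n : ℝ) ≤ k := by exact_mod_cast hkn
    rw [max_eq_right (sub_nonpos.2 hknr), max_eq_right hknr] at hc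
    by_cases hlast : (M : ℝ) * (2 * n - k) ≤ R0
    · refine (isCorner_strong_opportunistic hkn hk).achievable isCorner_full hlast
        (by linarith) ?_ ?_
      · have := mul_le_mul_of_nonneg_left hb (mul_nonneg hM0.le (sub_nonneg.2 hknr))
        linarith
      · intro he
        linarith
    · push Not at hlast
      refine (isCorner_strong hkn hk).achievable (isCorner_strong_opportunistic hkn hk)
        hR0 hlast.le ?_ ?_
      · have := mul_le_mul_of_nonneg_left hc (mul_nonneg hM0.le (sub_nonneg.2 hkr))
        linarith
      · intro he
        linarith

end Corners

end BurstyIC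

/-! ### Rescaling by n -/

theorem theorem2 {F : Type*} [Field F] [Fintype F] (n k M L : ℕ)
    (hn : 1 ≤ n) (hk : k ≤ 2 * n) (hM : 1 ≤ M) (hLM : L ≤ M) (hL : (M : ℝ) / 2 ≤ (L : ℝ))
    (α : ℝ) (hα : α = (k : ℝ) / (n : ℝ))
    (R0 RL : ℝ) (hR0 : 0 ≤ R0) (hRL : 0 ≤ RL) :
    (((M : ℝ) * RL + ((M : ℝ) - L) * R0
          ≤ (M : ℝ) * (((M : ℝ) - L) * (max (1 - α) 0 + max 1 α)
              + (2 * (L : ℝ) - M) * max α (1 - α)) * n ∧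
        RL + R0 ≤ (M : ℝ) * n ∧
        2 * RL + R0 ≤ (M : ℝ) * (max 1 α + max (1 - α) 0) * n) →
      BurstyIC.Achievable F n k M L R0 RL 0) ∧
    (BurstyIC.Achievable F n k M L R0 RL 0 →
      ((M : ℝ) * RL + ((M : ℝ) - L) * R0
          ≤ (M : ℝ) * (((M : ℝ) - L) * (max (1 - α) 0 + max 1 α)
              + (2 * (L : ℝ) - M) * max α (1 - α)) * n ∧
        RL + R0 ≤ (M : ℝ) * n)) := by
  have hn0 : (0 : ℝ) < n := by exact_mod_cast hn
  have hML : M ≤ 2 * L := by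
    have : (M : ℝ) ≤ 2 * L := by linarith
    exact_mod_cast this
  have hαn : α * n = k := by rw [hα, div_mul_cancel₀ _ hn0.ne']
  have e1 : max (1 - α) 0 * n = max ((n : ℝ) - k) 0 := by
    rw [max_mul_of_nonneg _ _ hn0.le, sub_mul, hαn, one_mul, zero_mul]
  have e2 : max 1 α * n = max (n : ℝ) k := by
    rw [max_mul_of_nonneg _ _ hn0.le, hαn, one_mul]
  have e3 : max α (1 - α) * n = max (k : ℝ) (n - k) := by
    rw [max_mul_of_nonneg _ _ hn0.le, sub_mul, hαn, one_mul]
  have ea : (M : ℝ) * (((M : ℝ) - L) * (max (1 - α) 0 + max 1 α)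
      + (2 * (L : ℝ) - M) * max α (1 - α)) * n =
      M * (((M : ℝ) - L) * (max ((n : ℝ) - k) 0 + max (n : ℝ) k) +
        (2 * (L : ℝ) - M) * max (k : ℝ) (n - k)) := by
    rw [← e1, ← e2, ← e3]
    ring
  have ec : (M : ℝ) * (max 1 α + max (1 - α) 0) * n =
      M * (max (n : ℝ) k + max ((n : ℝ) - k) 0) := by
    rw [← e1, ← e2]
    ring
  rw [ea, ec]
  refine ⟨fun ⟨ha, hb, hc⟩ =>
    BurstyIC.achievable_of_inner_bounds hM hk hLM hR0 hRL ha hb hc, fun h => ?_⟩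
  have hout := h.outer_bounds hM hML hLM
  have e4 : ((n - k : ℕ) : ℝ) = max ((n : ℝ) - k) 0 := by
    rcases le_total k n with hkn | hkn
    · rw [Nat.cast_sub hkn, max_eq_left (by simpa using hkn)]
    · rw [Nat.sub_eq_zero_of_le hkn, Nat.cast_zero, max_eq_right (by simpa using hkn)]
  -- The truncation at 0 is harmless because k ≥ 0.
  have e5 : max (k : ℝ) (max ((n : ℝ) - k) 0) = max (k : ℝ) (n - k) := by
    rw [max_comm ((n : ℝ) - k), ← max_assoc, max_eq_left (Nat.cast_nonneg (α := ℝ) k)]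
  rwa [Nat.cast_max, Nat.cast_max, e4, e5] at hout
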